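/- Let $H=\left\{\begin{pmatrix}1&x&z\\0&1&y\\0&0&1\end{pmatrix}: x,y,z\in\mathbb R\right\}$ be the real Heisenberg group, $\Gamma\subset H$ the lattice of matrices with integer entries, $N=\Gamma\backslash H$ the quotient by left multiplication, and $S^1=\mathbb R/2\pi\mathbb Z$. Let $M=N\times S^1\times S^1$ with its real-analytic structure; it is a compact connected manifold without boundary. A foliation by circles of $M$ is a one-dimensional foliation all of whose leaves are embedded circles; it is of unbounded length if for some (equivalently, by compactness of $M$, for every) Riemannian metric on $M$ the lengths of its leaves are not bounded. A pseudo-Riemannian metric $g$ is a field of nondegenerate symmetric bilinear forms on the tangent spaces; a geodesic is a curve $\gamma$ with $D_{\dot\gamma}\dot\gamma=0$ for the Levi-Civita connection $D$ of $g$. A leaf is spacelike, lightlike or timelike if $g(v,v)>0$, $=0$ or $<0$, respectively, for all nonzero vectors $v$ tangent to it. **Theorem.** 1. There exist a real-analytic foliation by circles $\mathcal F$ of unbounded length on $M$ and a real-analytic pseudo-Riemannian metric $g$ on $M$ such that every leaf of $\mathcal F$ is a closed geodesic of $g$ and every leaf of $\mathcal F$ is lightlike. 2. There exist a smooth ($C^\infty$)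 foliation by circles $\mathcal F$ of unbounded length on $M$ and a smooth pseudo-Riemannian metric $g$ on $M$ such that every leaf of $\mathcal F$ is a closed geodesic of $g$ and $\mathcal F$ has a spacelike leaf, a timelike leaf and a lightlike leaf. -/

import Mathlib

open Set Filter Topology
open scoped Manifold ContDiff Real

noncomputable section

/-! ### The manifold `N × S¹ × S¹` -/

/-- If the fibres of a surjective local homeomorphism `f : E → Q` are related by analytic maps
commuting with `f`, then the local inverses of `f` form an analytic atlas of `Q`. -/
theorem IsLocalHomeomorph.isManifold_chartedSpace
    {E : Type*} [NormedAddCommGroup E] [NormedSpace ℝ E] {Q : Type*} [TopologicalSpace Q]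
    {f : E → Q} (hf : IsLocalHomeomorph f) (hs : Function.Surjective f)
    (deck : ∀ a b, f a = f b → ∃ τ : E → E, ContDiff ℝ ω τ ∧ τ a = b ∧ ∀ x, f (τ x) = f x) :
    @IsManifold ℝ _ E _ _ E _ 𝓘(ℝ, E) ω Q _ (hf.chartedSpace hs) := by
  let _ : ChartedSpace E Q := hf.chartedSpace hs
  have key : ∀ e ∈ atlas E Q, ⇑e.symm = f ∧ InjOn f e.target := by
    rintro e ⟨q, rfl⟩
    have h1 : ⇑((hf.localInverseAt (hs.hasRightInverse.choose q)).trans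
        (chartAt E (hs.hasRightInverse.choose q))).symm = f := by
      ext z
      change (hf.localInverseAt (hs.hasRightInverse.choose q)).symm z = f z
      rw [hf.localInverseAt_symm]
    refine ⟨h1, ?_⟩
    have h2 := ((hf.localInverseAt (hs.hasRightInverse.choose q)).trans
        (chartAt E (hs.hasRightInverse.choose q))).symm.injOn
    intro a ha b hb hab
    exact h2 ha hb (by rw [h1, hab])
  refine isManifold_of_contDiffOn 𝓘(ℝ, E) ω Q ?_
  intro e e' he he' z hz
  obtain ⟨h1, -⟩ := key e he
  obtain ⟨h1', h2'⟩ := key e' he'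
  have hz' : z ∈ (e.symm.trans e').source := by simpa using hz
  have hfe' : ∀ y ∈ e'.source, f (e' y) = y := fun y hy => by
    rw [← h1']; exact e'.left_inv hy
  have hsrc : ∀ y ∈ (e.symm.trans e').source, f y ∈ e'.source := fun y hy => by
    have := hy.2
    simpa [h1] using this
  obtain ⟨τ, hτ, hτz, hfτ⟩ := deck z (e' (f z)) (hfe' _ (hsrc z hz')).symm
  have hev : ∀ᶠ y in 𝓝 z, y ∈ (e.symm.trans e').source ∧ τ y ∈ e'.target := by
    have h3 : ∀ᶠ y in 𝓝 z, y ∈ (e.symm.trans e').source :=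
      (e.symm.trans e').open_source.mem_nhds hz'
    refine h3.and (hτ.continuous.continuousAt.eventually_mem (e'.open_target.mem_nhds ?_))
    rw [hτz]
    exact e'.map_source (hsrc z hz')
  have hEq : (𝓘(ℝ, E) ∘ e.symm.trans e' ∘ 𝓘(ℝ, E).symm) =ᶠ[𝓝 z] τ := by
    filter_upwards [hev] with y hy
    have hy1 := hsrc y hy.1
    have : e' (f y) = τ y := h2' (e'.map_source hy1) hy.2 (by rw [hfe' _ hy1, hfτ])
    simpa [h1] using this
  exact (hτ.contDiffAt.congr_of_eventuallyEq hEq).contDiffWithinAt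

/-- The three-dimensional real Heisenberg group: the triple `(x, y, z)` stands for the matrix
`!![1, x, z; 0, 1, y; 0, 0, 1]`, see `Heisenberg.toMatrix_mul`. As a manifold it is `ℝ³`. -/
def Heisenberg : Type := ℝ × ℝ × ℝ

namespace Heisenberg

instance : NormedAddCommGroup Heisenberg := inferInstanceAs (NormedAddCommGroup (ℝ × ℝ × ℝ))
instance : NormedSpace ℝ Heisenberg := inferInstanceAs (NormedSpace ℝ (ℝ × ℝ × ℝ))
instance : FiniteDimensional ℝ Heisenberg := inferInstanceAs (FiniteDimensional ℝ (ℝ × ℝ × ℝ))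

/-- The point with matrix `!![1, x, z; 0, 1, y; 0, 0, 1]`. -/
def mk (x y z : ℝ) : Heisenberg := (x, y, z)

def x (p : Heisenberg) : ℝ := p.1
def y (p : Heisenberg) : ℝ := p.2.1
def z (p : Heisenberg) : ℝ := p.2.2

@[simp] theorem x_mk (a b c : ℝ) : (mk a b c).x = a := rfl
@[simp] theorem y_mk (a b c : ℝ) : (mk a b c).y = b := rfl
@[simp] theorem z_mk (a b c : ℝ) : (mk a b c).z = c := rfl

@[ext] theorem ext {p q : Heisenberg} (hx : p.x = q.x) (hy : p.y = q.y) (hz : p.z = q.z) :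
    p = q :=
  Prod.ext hx (Prod.ext hy hz)

/-- The matrix represented by a point of the Heisenberg group. -/
def toMatrix (p : Heisenberg) : Matrix (Fin 3) (Fin 3) ℝ :=
  !![1, p.x, p.z; 0, 1, p.y; 0, 0, 1]

instance : Group Heisenberg where
  mul p q := mk (p.x + q.x) (p.y + q.y) (p.z + q.z + p.x * q.y)
  one := mk 0 0 0
  inv p := mk (-p.x) (-p.y) (-p.z + p.x * p.y)
  mul_assoc p q r := by
    apply ext
    · exact add_assoc _ _ _
    · exact add_assoc _ _ _
    · change p.z + q.z + p.x * q.y + r.z + (p.x + q.x) * r.y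
        = p.z + (q.z + r.z + q.x * r.y) + p.x * (q.y + r.y)
      ring
  one_mul p := by
    apply ext
    · exact zero_add _
    · exact zero_add _
    · change 0 + p.z + 0 * p.y = p.z
      ring
  mul_one p := by
    apply ext
    · exact add_zero _
    · exact add_zero _
    · change p.z + 0 + p.x * 0 = p.z
      ring
  inv_mul_cancel p := by
    apply ext
    · exact neg_add_cancel _
    · exact neg_add_cancel _
    · change -p.z + p.x * p.y + p.z + -p.x * p.y = 0
      ring

@[simp] theorem x_mul (p q : Heisenberg) : (p * q).x = p.x + q.x := rfl
@[simp] theorem y_mul (p q : Heisenberg) : (p * q).y = p.y + q.y := rfl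
@[simp] theorem z_mul (p q : Heisenberg) : (p * q).z = p.z + q.z + p.x * q.y := rfl
@[simp] theorem x_one : (1 : Heisenberg).x = 0 := rfl
@[simp] theorem y_one : (1 : Heisenberg).y = 0 := rfl
@[simp] theorem z_one : (1 : Heisenberg).z = 0 := rfl
@[simp] theorem x_inv (p : Heisenberg) : p⁻¹.x = -p.x := rfl
@[simp] theorem y_inv (p : Heisenberg) : p⁻¹.y = -p.y := rfl
@[simp] theorem z_inv (p : Heisenberg) : p⁻¹.z = -p.z + p.x * p.y := rfl

/-- The group law of `Heisenberg` is matrix multiplication. -/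
theorem toMatrix_mul (p q : Heisenberg) : (p * q).toMatrix = p.toMatrix * q.toMatrix := by
  ext i j
  fin_cases i <;> fin_cases j <;> simp [toMatrix, Matrix.mul_apply, Fin.sum_univ_three] <;> ring

theorem contDiff_x : ContDiff ℝ ω (x : Heisenberg → ℝ) :=
  (contDiff_fst : ContDiff ℝ ω (Prod.fst : ℝ × ℝ × ℝ → ℝ))
theorem contDiff_y : ContDiff ℝ ω (y : Heisenberg → ℝ) :=
  (contDiff_fst.comp contDiff_snd : ContDiff ℝ ω (fun p : ℝ × ℝ × ℝ => p.2.1))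
theorem contDiff_z : ContDiff ℝ ω (z : Heisenberg → ℝ) :=
  (contDiff_snd.comp contDiff_snd : ContDiff ℝ ω (fun p : ℝ × ℝ × ℝ => p.2.2))

theorem contDiff_mk {E : Type*} [NormedAddCommGroup E] [NormedSpace ℝ E] {f g h : E → ℝ}
    (hf : ContDiff ℝ ω f) (hg : ContDiff ℝ ω g) (hh : ContDiff ℝ ω h) :
    ContDiff ℝ ω (fun e => mk (f e) (g e) (h e)) :=
  (hf.prodMk (hg.prodMk hh) : ContDiff ℝ ω (fun e => ((f e, g e, h e) : ℝ × ℝ × ℝ)))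

theorem contDiff_mul :
    ContDiff ℝ ω (fun p : Heisenberg × Heisenberg => p.1 * p.2) := by
  have h1 := contDiff_fst (𝕜 := ℝ) (n := ω) (E := Heisenberg) (F := Heisenberg)
  have h2 := contDiff_snd (𝕜 := ℝ) (n := ω) (E := Heisenberg) (F := Heisenberg)
  exact contDiff_mk ((contDiff_x.comp h1).add (contDiff_x.comp h2))
    ((contDiff_y.comp h1).add (contDiff_y.comp h2))
    (((contDiff_z.comp h1).add (contDiff_z.comp h2)).add
      ((contDiff_x.comp h1).mul (contDiff_y.comp h2)))

theorem contDiff_inv : ContDiff ℝ ω (fun p : Heisenberg => p⁻¹) :=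
  contDiff_mk contDiff_x.neg contDiff_y.neg (contDiff_z.neg.add (contDiff_x.mul contDiff_y))

instance : IsTopologicalGroup Heisenberg where
  continuous_mul := contDiff_mul.continuous
  continuous_inv := contDiff_inv.continuous

/-- The lattice of matrices with integer entries. -/
def lattice : Subgroup Heisenberg where
  carrier := {p | ∃ a b c : ℤ, p = mk a b c}
  mul_mem' := by
    rintro _ _ ⟨a, b, c, rfl⟩ ⟨a', b', c', rfl⟩
    exact ⟨a + a', b + b', c + c' + a * b', by ext <;> simp⟩
  one_mem' := ⟨0, 0, 0, by ext <;> simp⟩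
  inv_mem' := by
    rintro _ ⟨a, b, c, rfl⟩
    exact ⟨-a, -b, -c + a * b, by ext <;> simp⟩

instance : DiscreteTopology lattice := by
  refine discreteTopology_of_isOpen_singleton_one ?_
  have hU : IsOpen {p : Heisenberg | |p.x| < 1 ∧ |p.y| < 1 ∧ |p.z| < 1} :=
    (isOpen_lt contDiff_x.continuous.abs continuous_const).inter
      ((isOpen_lt contDiff_y.continuous.abs continuous_const).inter
        (isOpen_lt contDiff_z.continuous.abs continuous_const))
  convert hU.preimage (continuous_subtype_val (p := fun p => p ∈ lattice))
  ext ⟨p, a, b, c, rfl⟩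
  constructor
  · intro h
    have h' : mk a b c = 1 := congrArg Subtype.val (mem_singleton_iff.1 h)
    simp [h']
  · rintro ⟨h1, h2, h3⟩
    rw [x_mk] at h1
    rw [y_mk] at h2
    rw [z_mk] at h3
    have e1 : a = 0 := Int.abs_lt_one_iff.1 (by exact_mod_cast h1)
    have e2 : b = 0 := Int.abs_lt_one_iff.1 (by exact_mod_cast h2)
    have e3 : c = 0 := Int.abs_lt_one_iff.1 (by exact_mod_cast h3)
    subst e1 e2 e3
    refine mem_singleton_iff.2 (Subtype.ext ?_)
    ext <;> simp

instance : ProperlyDiscontinuousSMul lattice Heisenberg :=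
  lattice.properlyDiscontinuousSMul_of_tendsto_cofinite
    (lattice.tendsto_coe_cofinite_of_discrete ⟨inferInstanceAs (DiscreteTopology lattice)⟩)

end Heisenberg

/-- The Heisenberg nilmanifold `N = Γ \ H`: the quotient of the Heisenberg group by the left
multiplication action of the lattice of integer matrices. Its charts are the local inverses of
the projection `Heisenberg → N`. -/
abbrev Nilmanifold : Type := MulAction.orbitRel.Quotient Heisenberg.lattice Heisenberg

instance : ChartedSpace Heisenberg Nilmanifold := MulAction.instChartedSpaceQuotient

instance : IsManifold 𝓘(ℝ, Heisenberg) ω Nilmanifold :=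
  IsLocalHomeomorph.isManifold_chartedSpace _ Quotient.mk_surjective fun a b hab => by
    obtain ⟨γ, hγ⟩ := Quotient.exact hab.symm
    exact ⟨fun p => γ • p, Heisenberg.contDiff_mul.comp (contDiff_const.prodMk contDiff_id), hγ,
      fun x => Quotient.sound ⟨γ, rfl⟩⟩

/-- The circle `S¹ = ℝ / 2πℤ`. -/
abbrev Circ : Type := AddCircle (2 * π)

/-- The charts of `ℝ / 2πℤ` are the local inverses of the projection `ℝ → ℝ / 2πℤ`. -/
instance : ChartedSpace ℝ Circ :=
  (AddCircle.isLocalHomeomorph_coe (2 * π)).chartedSpace QuotientAddGroup.mk_surjective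

instance : IsManifold 𝓘(ℝ, ℝ) ω Circ :=
  IsLocalHomeomorph.isManifold_chartedSpace _ _ fun a b hab => by
    refine ⟨fun t => t + (b - a), contDiff_id.add contDiff_const, by ring, fun x => ?_⟩
    rw [AddCircle.coe_add, AddCircle.coe_sub, hab, sub_self, add_zero]

/-- The five-dimensional manifold `N × S¹ × S¹`. -/
abbrev ThurstonManifold : Type := Nilmanifold × Circ × Circ

/-- The model of `N × S¹ × S¹`: the space `Heisenberg × ℝ × ℝ`, without boundary. -/
abbrev thurstonModel : ModelWithCorners ℝ (Heisenberg × ℝ × ℝ)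
    (ModelProd Heisenberg (ModelProd ℝ ℝ)) :=
  𝓘(ℝ, Heisenberg).prod (𝓘(ℝ, ℝ).prod 𝓘(ℝ, ℝ))

/-! ### Pseudo-Riemannian metrics and geodesics -/

section Geometry

variable {E : Type*} [NormedAddCommGroup E] [NormedSpace ℝ E] {H : Type*} [TopologicalSpace H]
  {I : ModelWithCorners ℝ E H} {M : Type*} [TopologicalSpace M] [ChartedSpace H M]

variable (I M) in
/-- A pseudo-Riemannian metric of class `C^n` on `M`: a `C^n` field of nondegenerate symmetric
bilinear forms on the tangent spaces. (On a connected manifold its index is then constant.) -/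
structure PseudoRiemannianMetric [IsManifold I 1 M] (n : ℕ∞ω) where
  inner (x : M) : TangentSpace I x →L[ℝ] TangentSpace I x →L[ℝ] ℝ
  symm (x : M) (v w : TangentSpace I x) : inner x v w = inner x w v
  nondegenerate (x : M) (v : TangentSpace I x) (hv : ∀ w, inner x v w = 0) : v = 0
  contMDiff : ContMDiff I (I.prod 𝓘(ℝ, E →L[ℝ] E →L[ℝ] ℝ)) n
    (fun x => Bundle.TotalSpace.mk' (E →L[ℝ] E →L[ℝ] ℝ)
      (E := fun x => TangentSpace I x →L[ℝ] TangentSpace I x →L[ℝ] ℝ) x (inner x))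

/-- The velocity vector `γ'(t)` of a curve. -/
def velocity (I : ModelWithCorners ℝ E H) (γ : ℝ → M) (t : ℝ) : TangentSpace I (γ t) :=
  mfderiv 𝓘(ℝ, ℝ) I γ t (1 : ℝ)

namespace PseudoRiemannianMetric

variable [IsManifold I 1 M] {n : ℕ∞ω} (g : PseudoRiemannianMetric I M n)

/-- The metric in the coordinates given by the preferred chart at `x₀`: the value at the
coordinate point `p` of the pulled back bilinear form on the coordinate vectors `v`, `w`. -/
def coord (x₀ : M) (v w p : E) : ℝ :=
  g.inner ((extChartAt I x₀).symm p)
    (mfderiv 𝓘(ℝ, E) I (extChartAt I x₀).symm p v)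
    (mfderiv 𝓘(ℝ, E) I (extChartAt I x₀).symm p w)

/-- The Christoffel symbols of the first kind of the Levi-Civita connection in the coordinates
given by the preferred chart at `x₀`:
`g(D_u v, w) = (∂_u g(v, w) + ∂_v g(u, w) - ∂_w g(u, v)) / 2` for constant coordinate
vector fields `u`, `v`, `w`. -/
def christoffel (x₀ : M) (u v w p : E) : ℝ :=
  (fderiv ℝ (g.coord x₀ v w) p u + fderiv ℝ (g.coord x₀ u w) p v
    - fderiv ℝ (g.coord x₀ u v) p w) / 2

/-- A smooth curve `γ : ℝ → M` in a manifold without boundary is a geodesic of `g` (affinely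
parametrized) if `D_γ' γ' = 0` for the Levi-Civita connection `D`. In each chart of the atlas, with
`c` the coordinate expression of `γ`, this says `g(c'', w) + Γ(c', c'; w) = 0` for all `w`,
which is the usual geodesic equation with its index lowered by the nondegenerate form `g`. -/
def IsGeodesic (γ : ℝ → M) : Prop :=
  ContMDiff 𝓘(ℝ, ℝ) I ∞ γ ∧
    ∀ (x₀ : M) (t : ℝ), γ t ∈ (chartAt H x₀).source → ∀ w : E,
      let c : ℝ → E := extChartAt I x₀ ∘ γ
      g.coord x₀ (deriv (deriv c) t) w (c t) + g.christoffel x₀ (deriv c t) (deriv c t) w (c t) = 0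

end PseudoRiemannianMetric

/-! ### One-dimensional foliations -/

variable (I M) in
/-- A one-dimensional foliation of class `C^n` on `M`, given by its tangent line field: near each
point the line field is spanned by a nowhere vanishing vector field of class `C^n`. -/
structure LineFoliation [IsManifold I 1 M] (n : ℕ∞ω) where
  line (x : M) : Submodule ℝ (TangentSpace I x)
  exists_local_frame (x : M) : ∃ U ∈ 𝓝 x, ∃ X : (y : M) → TangentSpace I y,
    ContMDiffOn I I.tangent n (fun y => (⟨y, X y⟩ : TangentBundle I M)) U ∧
    ∀ y ∈ U, X y ≠ 0 ∧ line y = Submodule.span ℝ {X y}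

namespace LineFoliation

variable [IsManifold I 1 M] {n m : ℕ∞ω} (F : LineFoliation I M n)

/-- A smooth curve everywhere tangent to the foliation. -/
def IsTangentCurve (γ : ℝ → M) : Prop :=
  ContMDiff 𝓘(ℝ, ℝ) I ∞ γ ∧ ∀ t, velocity I γ t ∈ F.line (γ t)

/-- The leaf through `x`: all points that can be joined to `x` by a smooth curve tangent to the
foliation. -/
def leaf (x : M) : Set M :=
  {y | ∃ γ : ℝ → M, F.IsTangentCurve γ ∧ ∃ a b : ℝ, γ a = x ∧ γ b = y}

/-- `γ` is a regular simple closed parametrization, with minimal period `T`, of the leaf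
through `x`. -/
structure IsCircleParam (x : M) (γ : ℝ → M) (T : ℝ) : Prop where
  tangent : F.IsTangentCurve γ
  velocity_ne_zero : ∀ t, velocity I γ t ≠ 0
  period_pos : 0 < T
  periodic : Function.Periodic γ T
  injOn : InjOn γ (Ico 0 T)
  range_eq : range γ = F.leaf x

/-- A foliation by circles: every leaf is a smoothly embedded circle. -/
def IsByCircles : Prop := ∀ x, ∃ γ T, F.IsCircleParam x γ T

/-- For the Riemannian metric `h`, the lengths of the circle leaves of `F` are unbounded. -/
def UnboundedLengthFor
    (h : Bundle.ContMDiffRiemannianMetric I ∞ E (fun x : M => TangentSpace I x)) : Prop :=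
  ∀ C : ℝ, ∃ x γ T, F.IsCircleParam x γ T ∧
    C < ∫ t in (0 : ℝ)..T, √(h.inner (γ t) (velocity I γ t) (velocity I γ t))

/-- The lengths of the circle leaves are unbounded, for some and for every smooth Riemannian metric
on the (compact) manifold `M`. -/
def HasUnboundedLength : Prop :=
  (∃ h, F.UnboundedLengthFor h) ∧ ∀ h, F.UnboundedLengthFor h

variable (g : PseudoRiemannianMetric I M m)

/-- Every leaf is a closed geodesic of `g`: it has a simple closed parametrization which is
a geodesic. -/
def IsGeodesic : Prop := ∀ x, ∃ γ T, F.IsCircleParam x γ T ∧ g.IsGeodesic γ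

/-- The leaf through `x` is lightlike. -/
def IsLightlikeLeaf (x : M) : Prop :=
  ∀ y ∈ F.leaf x, ∀ v ∈ F.line y, v ≠ 0 → g.inner y v v = 0

/-- The leaf through `x` is spacelike. -/
def IsSpacelikeLeaf (x : M) : Prop :=
  ∀ y ∈ F.leaf x, ∀ v ∈ F.line y, v ≠ 0 → 0 < g.inner y v v

/-- The leaf through `x` is timelike. -/
def IsTimelikeLeaf (x : M) : Prop :=
  ∀ y ∈ F.leaf x, ∀ v ∈ F.line y, v ≠ 0 → g.inner y v v < 0

end LineFoliation

end Geometry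

end

/-! On the cover, with coordinates `x, y, z, t, u` and left-invariant fields `X, Y, Z`, choose
periodic `φ(u)`, `ψ(u)` with `φ² + ψ² = 1` and put `V = 2φψ (cos t X + sin t Y) - ψ² Z + 2φ² ∂_t`.
Along an orbit `u` is constant. If `φ ≠ 0`, then during time `π/φ²` the coordinate `t` gains `2π`
and `(x, y)` runs once round a circle of radius `|ψ/φ|`. The horizontal part lifts `z` by the
enclosed area `πψ²/φ²`, and `-ψ² Z` lowers it by the same amount. So the orbit closes up except for
`t`, which lives on a circle (`hasDerivAt_circularFlow`, `periodic_circularFlow`). If `φ = 0`, then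
`V = -Z` and the orbit closes in the nilmanifold. The periods `π/φ²` blow up near a zero of `φ`, and
on a compact manifold so do the lengths (`unboundedLengthFor`).

Let `k` be `riemannForm`. Then `k(V, V) = 1`; put `α = k(V, ·)`. Correcting `k` by products of `α`,
`du`, `dt` gives a symmetric form `g` with `g(V, ·) = β = du + σ(u) dt` (`metricForm_field`),
nondegenerate when `2σφ² < 1` (`metricForm_nondegenerate`). The Koszul formula gives `g(D_V V, ·) =
i_V dβ + d(β(V))/2 = (σ(φ²)' - σ'φ²) du`, so the orbits are geodesics exactly when `σ'φ² = σ(φ²)'`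
(`geodesic_equation`). Their causal type is the sign of `g(V, V) = 2σφ²`, constant on each leaf
(`exists_inner_eq_mul`).

With `σ = 0`, `φ = sin`, `ψ = cos` everything is analytic and lightlike. If `φ` vanishes to infinite
order at the multiples of `π`, then `σ = ±φ²` with the sign of `sin u` is smooth and all three types
occur.

Everything is computed on the cover and descends because it is invariant under deck transformations;
`leaf_eq_range` identifies the leaves with the projected orbits. -/

noncomputable section

/-! ### Descent of invariant fields and forms along the covering map -/

section ChartCover

variable {E : Type*} [NormedAddCommGroup E] [NormedSpace ℝ E] {H : Type*} [TopologicalSpace H]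
  {I : ModelWithCorners ℝ E H} {M : Type*} [TopologicalSpace M] [ChartedSpace H M]

/-- `P : E → M` is a covering all of whose local inverses are charts, and any two points of a fibre
are related by one of the analytic deck transformations in `D`. -/
structure IsChartCover (I : ModelWithCorners ℝ E H) (P : E → M)
    (D : Set (E → E)) : Prop where
  extChartAt_symm (x : M) : ⇑(extChartAt I x).symm = P
  contDiff : ∀ τ ∈ D, ContDiff ℝ ω τ
  apply_deck : ∀ τ ∈ D, ∀ p, P (τ p) = P p
  exists_deck : ∀ p q, P p = P q → ∃ τ ∈ D, τ p = q

/-- A vector field on `E` that is preserved by the maps in `D`. -/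
def IsInvariantField (D : Set (E → E)) (V : E → E) : Prop :=
  ∀ τ ∈ D, ∀ p, V (τ p) = fderiv ℝ τ p (V p)

/-- A field of bilinear forms on `E` that is preserved by the maps in `D`. -/
def IsInvariantForm (D : Set (E → E)) (G : E → E →L[ℝ] E →L[ℝ] ℝ) : Prop :=
  ∀ τ ∈ D, ∀ p v w, G (τ p) (fderiv ℝ τ p v) (fderiv ℝ τ p w) = G p v w

/-- The vector field on `M` whose lift to the coordinates is `V`. -/
def descendField (I : ModelWithCorners ℝ E H) (V : E → E) (x : M) :
    TangentSpace I x := V (extChartAt I x x)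

/-- The field of bilinear forms on `M` whose lift to the coordinates is `G`. -/
def descendForm (I : ModelWithCorners ℝ E H) (G : E → E →L[ℝ] E →L[ℝ] ℝ)
    (x : M) : TangentSpace I x →L[ℝ] TangentSpace I x →L[ℝ] ℝ := G (extChartAt I x x)

namespace IsChartCover

variable {P : E → M} {D : Set (E → E)} (hP : IsChartCover I P D)
include hP

theorem extChartAt_self (x : M) : P (extChartAt I x x) = x := by
  rw [← hP.extChartAt_symm x, extChartAt_to_inv]

theorem apply_extChartAt {x₀ x : M} (hx : x ∈ (chartAt H x₀).source) :
    P (extChartAt I x₀ x) = x := by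
  rw [← hP.extChartAt_symm x₀]
  exact (extChartAt I x₀).left_inv (by rwa [extChartAt_source])

variable [IsManifold I ω M] [I.Boundaryless]

/-- A deck transformation moves `p` to the preferred coordinates of `P p`, and there `P` is the
inverse of a chart. -/
theorem contMDiff : ContMDiff 𝓘(ℝ, E) I ω P := by
  intro p
  obtain ⟨τ, hτ, h⟩ := hP.exists_deck _ _ (hP.extChartAt_self (P p)).symm
  have h1 : P = P ∘ τ := funext fun q => (hP.apply_deck τ hτ q).symm
  rw [h1]
  refine ContMDiffAt.comp p ?_ (hP.contDiff τ hτ).contMDiff.contMDiffAt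
  have h2 := (contMDiffOn_extChartAt_symm (I := I) (n := ω) (P p)).contMDiffAt
    (extChartAt_target_mem_nhds (P p))
  rwa [hP.extChartAt_symm (P p), ← h] at h2

theorem mdifferentiableAt (p : E) : MDifferentiableAt 𝓘(ℝ, E) I P p :=
  hP.contMDiff.mdifferentiable (by simp) p

/-- The tangent space at `x` is identified with `E` through the preferred chart at `x`, which `P`
inverts locally. -/
theorem mfderiv_extChartAt_self (x : M) (v : E) :
    mfderiv 𝓘(ℝ, E) I P (extChartAt I x x) v = v := by
  have : IsManifold I 1 M := .of_le (n := ω) le_top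
  have h := mfderivWithin_range_extChartAt_symm (I := I) (x := x)
  rw [hP.extChartAt_symm x, I.range_eq_univ, mfderivWithin_univ] at h
  exact congrArg (fun f : E →L[ℝ] E => f v) h

/-- At an arbitrary point of the fibre, `dP` is the differential of a deck transformation to the
preferred point. This turns descent into invariance under `D`. -/
theorem exists_mfderiv_eq (p : E) :
    ∃ τ ∈ D, τ p = extChartAt I (P p) (P p) ∧
      ∀ v : E, (mfderiv 𝓘(ℝ, E) I P p v : E) = fderiv ℝ τ p v := by
  obtain ⟨τ, hτ, h⟩ := hP.exists_deck _ _ (hP.extChartAt_self (P p)).symm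
  refine ⟨τ, hτ, h, fun v => ?_⟩
  have h1 : P = P ∘ τ := funext fun q => (hP.apply_deck τ hτ q).symm
  have h2 : mfderiv 𝓘(ℝ, E) I P p v = mfderiv 𝓘(ℝ, E) I (P ∘ τ) p v := by rw [← h1]
  have h3 := mfderiv_comp_apply p (hP.mdifferentiableAt (τ p))
    ((hP.contDiff τ hτ).contMDiff.mdifferentiable (by simp) p) v
  have h4 := hP.mfderiv_extChartAt_self (P p) (fderiv ℝ τ p v)
  rw [mfderiv_eq_fderiv] at h3
  rw [← h] at h4
  exact h2.trans (h3.trans h4)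

theorem mfderiv_field {V : E → E} (hV : IsInvariantField D V) (p : E) :
    mfderiv 𝓘(ℝ, E) I P p (V p) = descendField I V (P p) := by
  obtain ⟨τ, hτ, h, h'⟩ := hP.exists_mfderiv_eq p
  refine (h' _).trans ?_
  rw [← hV τ hτ, h]
  rfl

theorem descendForm_mfderiv {G : E → E →L[ℝ] E →L[ℝ] ℝ} (hG : IsInvariantForm D G) (p v w : E) :
    descendForm I G (P p) (mfderiv 𝓘(ℝ, E) I P p v) (mfderiv 𝓘(ℝ, E) I P p w) = G p v w := by
  obtain ⟨τ, hτ, h, h'⟩ := hP.exists_mfderiv_eq p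
  have h1 : descendForm I G (P p) (mfderiv 𝓘(ℝ, E) I P p v) (mfderiv 𝓘(ℝ, E) I P p w)
      = G (extChartAt I (P p) (P p)) (mfderiv 𝓘(ℝ, E) I P p v : E)
        (mfderiv 𝓘(ℝ, E) I P p w : E) := rfl
  rw [h1, h', h', ← h, hG τ hτ]

/-- Expresses the bundle trivialization through `dP`, so that smoothness of sections can be tested
on the cover. -/
theorem symmL_trivializationAt {x₀ x : M} (hx : x ∈ (chartAt H x₀).source) (v : E) :
    haveI : IsManifold I 1 M := .of_le (n := ω) le_top
    (trivializationAt E (TangentSpace I) x₀).symmL ℝ x v =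
      (mfderiv 𝓘(ℝ, E) I P (extChartAt I x₀ x) v : E) := by
  have : IsManifold I 1 M := .of_le (n := ω) le_top
  have h := TangentBundle.symmL_trivializationAt (I := I) hx
  rw [hP.extChartAt_symm x₀, I.range_eq_univ, mfderivWithin_univ] at h
  exact congrArg (fun f : E →L[ℝ] E => f v) h

/-- In the trivialization at `x₀` the section is just `V` read in the chart at `x₀`. -/
theorem contMDiff_field {n : ℕ∞ω} {V : E → E} (hV : IsInvariantField D V) (h : ContDiff ℝ n V) :
    haveI : IsManifold I 1 M := .of_le (n := ω) le_top
    ContMDiff I I.tangent n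
      (fun x : M => (⟨x, descendField I V x⟩ : TangentBundle I M)) := by
  have : IsManifold I 1 M := .of_le (n := ω) le_top
  intro x₀
  rw [Bundle.contMDiffAt_section]
  have h1 : ContMDiffAt I 𝓘(ℝ, E) n (fun x => V (extChartAt I x₀ x)) x₀ :=
    h.contMDiff.contMDiffAt.comp x₀ (contMDiffAt_extChartAt.of_le le_top)
  refine h1.congr_of_eventuallyEq ?_
  filter_upwards [(chartAt H x₀).open_source.mem_nhds (mem_chart_source H x₀)] with x hx
  have h2 := hP.mfderiv_field hV (extChartAt I x₀ x)
  rw [hP.apply_extChartAt hx] at h2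
  have h3 := (hP.symmL_trivializationAt hx (V (extChartAt I x₀ x))).trans h2
  have h4 := (trivializationAt E (TangentSpace I) x₀).continuousLinearMapAt_symmL (R := ℝ)
    (by simpa using hx) (V (extChartAt I x₀ x))
  rw [h3] at h4
  exact (congrFun (Bundle.Trivialization.coe_linearMapAt_of_mem (R := ℝ)
    (trivializationAt E (TangentSpace I) x₀) (by simpa using hx)) _).symm.trans h4

theorem contMDiff_form {n : ℕ∞ω} {G : E → E →L[ℝ] E →L[ℝ] ℝ} (hG : IsInvariantForm D G)
    (h : ContDiff ℝ n G) :
    haveI : IsManifold I 1 M := .of_le (n := ω) le_top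
    ContMDiff I (I.prod 𝓘(ℝ, E →L[ℝ] E →L[ℝ] ℝ)) n
      (fun x => Bundle.TotalSpace.mk' (E →L[ℝ] E →L[ℝ] ℝ)
      (E := fun x : M => TangentSpace I x →L[ℝ] TangentSpace I x →L[ℝ] ℝ) x
        (descendForm I G x)) := by
  have : IsManifold I 1 M := .of_le (n := ω) le_top
  intro x₀
  rw [contMDiffAt_hom_bundle]
  refine ⟨contMDiffAt_id, ?_⟩
  have h1 : ContMDiffAt I 𝓘(ℝ, E →L[ℝ] E →L[ℝ] ℝ) n (fun x => G (extChartAt I x₀ x)) x₀ :=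
    h.contMDiff.contMDiffAt.comp x₀ (contMDiffAt_extChartAt.of_le le_top)
  refine h1.congr_of_eventuallyEq ?_
  filter_upwards [(chartAt H x₀).open_source.mem_nhds (mem_chart_source H x₀)] with x hx
  ext v w
  have h2 := hP.descendForm_mfderiv hG (extChartAt I x₀ x) v w
  rw [hP.apply_extChartAt hx] at h2
  rw [← h2, inCoordinates_apply_eq₂ (by simpa using hx) (by simpa using hx) (by simp)]
  have h3 := hP.symmL_trivializationAt hx v
  have h4 := hP.symmL_trivializationAt hx w
  rw [Bundle.Trivialization.symmL_apply _ (by simpa using hx)] at h3 h4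
  rw [h3, h4]
  simp
  rfl

end IsChartCover
-- Curves and geodesics in lifted coordinates
namespace IsChartCover

variable {P : E → M} {D : Set (E → E)} (hP : IsChartCover I P D)
  [IsManifold I ω M] [I.Boundaryless]
include hP

theorem mfderiv_injective {x₀ x : M} (hx : x ∈ (chartAt H x₀).source) :
    Function.Injective fun v : E => (mfderiv 𝓘(ℝ, E) I P (extChartAt I x₀ x) v : E) := by
  have : IsManifold I 1 M := .of_le (n := ω) le_top
  have h := isInvertible_mfderivWithin_extChartAt_symm
    ((extChartAt I x₀).map_source (by rwa [extChartAt_source] : x ∈ (extChartAt I x₀).source))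
  rw [hP.extChartAt_symm x₀, I.range_eq_univ, mfderivWithin_univ] at h
  exact h.injective

/-- The coordinate expression of a curve is a lift of the curve. -/
theorem mfderiv_deriv_extChartAt {γ : ℝ → M} {n : ℕ∞ω} (hγ : ContMDiff 𝓘(ℝ, ℝ) I n γ) (hn : n ≠ 0)
    {x₀ : M} {t : ℝ} (ht : γ t ∈ (chartAt H x₀).source) :
    DifferentiableAt ℝ (extChartAt I x₀ ∘ γ) t ∧
    (mfderiv 𝓘(ℝ, E) I P (extChartAt I x₀ (γ t)) (deriv (extChartAt I x₀ ∘ γ) t) : E)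
      = velocity I γ t := by
  have : IsManifold I 1 M := .of_le (n := ω) le_top
  have h1 : MDifferentiableAt 𝓘(ℝ, ℝ) 𝓘(ℝ, E) (extChartAt I x₀ ∘ γ) t :=
    (mdifferentiableAt_extChartAt ht).comp t (hγ.mdifferentiable hn t)
  have h2 : γ =ᶠ[𝓝 t] P ∘ (extChartAt I x₀ ∘ γ) := by
    filter_upwards [hγ.continuous.continuousAt.eventually_mem
      ((chartAt H x₀).open_source.mem_nhds ht)] with s hs
    exact (hP.apply_extChartAt hs).symm
  refine ⟨h1.differentiableAt, ?_⟩
  have h3 := mfderiv_comp_apply t (hP.mdifferentiableAt ((extChartAt I x₀ ∘ γ) t)) h1 (1 : ℝ)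
  have h4 : (velocity I γ t : E) = mfderiv 𝓘(ℝ, ℝ) I (P ∘ (extChartAt I x₀ ∘ γ)) t (1 : ℝ) :=
    congrArg (fun f : ℝ →L[ℝ] E => f 1) h2.mfderiv_eq
  rw [h4]
  refine Eq.trans ?_ h3.symm
  rw [mfderiv_eq_fderiv]
  rfl

/-- `dP` is injective and carries both candidate derivatives to the velocity of `γ`; hence every
chart shows the same differential equation, that of `V`. -/
theorem deriv_extChartAt_comp {V : E → E} (hV : IsInvariantField D V) {γ : ℝ → M} {n : ℕ∞ω}
    (hγ : ContMDiff 𝓘(ℝ, ℝ) I n γ) (hn : n ≠ 0) {x₀ : M} {t : ℝ}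
    (ht : γ t ∈ (chartAt H x₀).source) {r : ℝ}
    (h : velocity I γ t = r • descendField I V (γ t)) :
    HasDerivAt (extChartAt I x₀ ∘ γ) (r • V (extChartAt I x₀ (γ t))) t := by
  obtain ⟨h1, h2⟩ := hP.mfderiv_deriv_extChartAt hγ hn ht
  have h3 := hP.mfderiv_field hV (extChartAt I x₀ (γ t))
  rw [hP.apply_extChartAt ht] at h3
  have h4 : deriv (extChartAt I x₀ ∘ γ) t = r • V (extChartAt I x₀ (γ t)) := by
    apply hP.mfderiv_injective ht
    change (mfderiv 𝓘(ℝ, E) I P (extChartAt I x₀ (γ t)) (deriv (extChartAt I x₀ ∘ γ) t) : E) = _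
    rw [h2, h, ← h3]
    exact ((mfderiv 𝓘(ℝ, E) I P (extChartAt I x₀ (γ t))).map_smul _ _).symm
  rw [← h4]
  exact h1.hasDerivAt

theorem hasMFDerivAt_comp {V : E → E} (hV : IsInvariantField D V) {c : ℝ → E} {t : ℝ}
    (hc : HasDerivAt c (V (c t)) t) :
    HasMFDerivAt 𝓘(ℝ, ℝ) I (P ∘ c) t
      ((1 : ℝ →L[ℝ] ℝ).smulRight (descendField I V ((P ∘ c) t))) := by
  have h := (hP.mdifferentiableAt (c t)).hasMFDerivAt.comp t hc.hasFDerivAt.hasMFDerivAt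
  refine h.congr_mfderiv (ContinuousLinearMap.ext fun (r : ℝ) => ?_)
  have h1 := hP.mfderiv_field hV (c t)
  exact ((mfderiv 𝓘(ℝ, E) I P (c t)).map_smul r (V (c t))).trans
    (congrArg (fun v : E => r • v) h1)

theorem coord_eq {G : E → E →L[ℝ] E →L[ℝ] ℝ} (hG : IsInvariantForm D G) [IsManifold I 1 M]
    {n : ℕ∞ω} (g : PseudoRiemannianMetric I M n) (hg : g.inner = descendForm I G) (x₀ : M)
    (v w p : E) : g.coord x₀ v w p = G p v w := by
  have h := hP.descendForm_mfderiv hG p v w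
  rw [← hg] at h
  rw [← h, PseudoRiemannianMetric.coord, hP.extChartAt_symm x₀]

/-- An integral curve of an invariant field satisfying the coordinate form of `D_V V = 0` is a
geodesic. -/
theorem isGeodesic_of_isIntegralCurve {V : E → E} (hV : IsInvariantField D V)
    (hVd : Differentiable ℝ V)
    {G : E → E →L[ℝ] E →L[ℝ] ℝ} (hG : IsInvariantForm D G) (hGd : Differentiable ℝ G)
    (hVG : ∀ p w, G p (fderiv ℝ V p (V p)) w + fderiv ℝ G p (V p) (V p) w
      - fderiv ℝ G p w (V p) (V p) / 2 = 0) [IsManifold I 1 M]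
    {n : ℕ∞ω} (g : PseudoRiemannianMetric I M n) (hg : g.inner = descendForm I G)
    {γ : ℝ → M} (hγ : ContMDiff 𝓘(ℝ, ℝ) I ∞ γ)
    (h : ∀ t, velocity I γ t = descendField I V (γ t)) : g.IsGeodesic γ := by
  refine ⟨hγ, fun x₀ t ht w => ?_⟩
  intro c
  have h1 : ∀ s, γ s ∈ (chartAt H x₀).source → HasDerivAt c (V (c s)) s := by
    intro s hs
    have := hP.deriv_extChartAt_comp hV hγ (by simp) hs (r := 1) (by rw [h s, one_smul])
    rwa [one_smul] at this
  have h2 : deriv c =ᶠ[𝓝 t] V ∘ c := by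
    filter_upwards [hγ.continuous.continuousAt.eventually_mem
      ((chartAt H x₀).open_source.mem_nhds ht)] with s hs
    exact (h1 s hs).deriv
  have h3 : deriv c t = V (c t) := (h1 t ht).deriv
  have h4 : deriv (deriv c) t = fderiv ℝ V (c t) (V (c t)) := by
    rw [h2.deriv_eq]
    exact ((hVd (c t)).hasFDerivAt.comp_hasDerivAt t (h1 t ht)).deriv
  have h5 : ∀ v w, g.coord x₀ v w = fun p => G p v w := fun v w =>
    funext fun p => hP.coord_eq hG g hg x₀ v w p
  have h6 : ∀ v w p u, fderiv ℝ (fun p => G p v w) p u = fderiv ℝ G p u v w := by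
    intro v w p u
    have h7 : HasFDerivAt G (fderiv ℝ G p) p := (hGd p).hasFDerivAt
    have h8 := (h7.clm_apply (hasFDerivAt_const v p)).clm_apply (hasFDerivAt_const w p)
    rw [h8.fderiv]
    simp
  -- With `V` in both first slots, two terms of the Christoffel symbol coincide; this is the source
  -- of the coefficients `1` and `-1/2` in `hVG`.
  rw [PseudoRiemannianMetric.christoffel, h3, h4]
  simp only [h5, h6]
  have := hVG (c t) w
  linarith

end IsChartCover
-- Leaves as projected orbits, and their lengths
/-- `Φ` is a global flow of `V` on `E`, and the orbit of `p` becomes in `M` a simple closed curve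
of period `T p`. -/
structure IsCircleFlow (P : E → M) (V : E → E) (Φ : E → ℝ → E) (T : E → ℝ) : Prop where
  apply_zero : ∀ p, Φ p 0 = p
  contDiff : ∀ p, ContDiff ℝ ∞ (Φ p)
  hasDerivAt : ∀ p t, HasDerivAt (Φ p) (V (Φ p t)) t
  period_pos : ∀ p, 0 < T p
  periodic : ∀ p, Function.Periodic (P ∘ Φ p) (T p)
  injOn : ∀ p, InjOn (P ∘ Φ p) (Ico 0 (T p))

namespace IsChartCover

variable {P : E → M} {D : Set (E → E)} (hP : IsChartCover I P D)
  [IsManifold I ω M] [I.Boundaryless]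

/-- The foliation of `M` spanned by an invariant nowhere vanishing vector field on the cover. -/
def foliation {n : ℕ∞ω} {V : E → E} (hV : IsInvariantField D V) (hVd : ContDiff ℝ n V)
    (hV0 : ∀ p, V p ≠ 0) [IsManifold I 1 M] : LineFoliation I M n where
  line x := Submodule.span ℝ {descendField I V x}
  exists_local_frame _ := ⟨univ, univ_mem, descendField I V, (hP.contMDiff_field hV hVd).contMDiffOn,
    fun y _ => ⟨hV0 (extChartAt I y y), rfl⟩⟩

variable {n : ℕ∞ω} {V : E → E} (hV : IsInvariantField D V) (hVd : ContDiff ℝ n V)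
  (hV0 : ∀ p, V p ≠ 0) {Φ : E → ℝ → E} {T : E → ℝ} (hΦ : IsCircleFlow P V Φ T)

include hP

theorem contMDiff_flow (hΦ : IsCircleFlow P V Φ T) (p : E) : ContMDiff 𝓘(ℝ, ℝ) I ∞ (P ∘ Φ p) :=
  (hP.contMDiff.of_le le_top).comp (hΦ.contDiff p).contMDiff

include hV hΦ

theorem velocity_flow (p : E) (t : ℝ) :
    velocity I (P ∘ Φ p) t = descendField I V ((P ∘ Φ p) t) := by
  rw [velocity, (hP.hasMFDerivAt_comp hV (hΦ.hasDerivAt p t)).mfderiv]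
  exact one_smul ℝ (descendField I V ((P ∘ Φ p) t))

/-- Uniqueness of integral curves on a Hausdorff manifold: orbits that meet are time shifts of one
another, so orbits are equal or disjoint. -/
theorem range_flow_eq [T2Space M] (hVd : ContDiff ℝ n V) (hn : 1 ≤ n) {p q : E} {s t : ℝ}
    (h : P (Φ p s) = P (Φ q t)) : range (P ∘ Φ p) = range (P ∘ Φ q) := by
  have h1 : ∀ p, IsMIntegralCurve (I := I) (P ∘ Φ p) (descendField I V) := fun p t =>
    hP.hasMFDerivAt_comp hV (hΦ.hasDerivAt p t)
  have h2 := isMIntegralCurve_Ioo_eq_of_contMDiff_boundaryless (t₀ := s)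
    (hP.contMDiff_field hV (hVd.of_le hn)) (h1 p) ((h1 q).comp_add (t - s))
    (by simpa using h)
  rw [h2]
  exact (Equiv.addRight (t - s)).surjective.range_comp (P ∘ Φ q)

variable [IsManifold I 1 M]

theorem isTangentCurve_flow (p : E) : (hP.foliation hV hVd hV0).IsTangentCurve (P ∘ Φ p) := by
  refine ⟨hP.contMDiff_flow hΦ p, fun t => ?_⟩
  rw [hP.velocity_flow hV hΦ]
  exact Submodule.mem_span_singleton_self _

-- Pairing with a functional that is nonzero on `V` at the point writes the speed locally as a
-- continuous quotient. Continuity is what allows the speed to be integrated to a change of time.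
omit hΦ in
theorem exists_continuous_speed {γ : ℝ → M} (hγ : (hP.foliation hV hVd hV0).IsTangentCurve γ) :
    ∃ r : ℝ → ℝ, Continuous r ∧ ∀ t, velocity I γ t = r t • descendField I V (γ t) := by
  have h1 : ∀ t, ∃ r : ℝ, r • descendField I V (γ t) = velocity I γ t := fun t =>
    Submodule.mem_span_singleton.1 (hγ.2 t)
  choose r hr using h1
  refine ⟨r, continuous_iff_continuousAt.2 fun t₀ => ?_, fun t => (hr t).symm⟩
  have hc : ContDiffAt ℝ ∞ (extChartAt I (γ t₀) ∘ γ) t₀ :=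
    ((contMDiffAt_extChartAt (n := ∞)).comp t₀ hγ.1.contMDiffAt).contDiffAt
  set c := extChartAt I (γ t₀) ∘ γ
  obtain ⟨L, hL⟩ := SeparatingDual.exists_ne_zero (R := ℝ) (hV0 (c t₀))
  have h2 : ContinuousAt (fun t => L (fderiv ℝ c t 1) / L (V (c t))) t₀ := by
    have h3 : ContinuousAt (fderiv ℝ c) t₀ :=
      (hc.fderiv_right (m := 0) (by simp)).continuousAt
    refine ContinuousAt.div (L.continuous.continuousAt.comp (h3.clm_apply continuousAt_const))
      ((L.continuous.comp hVd.continuous).continuousAt.comp hc.continuousAt) hL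
  refine h2.congr ?_
  have h4 : ∀ᶠ t in 𝓝 t₀, L (V (c t)) ≠ 0 :=
    ((L.continuous.comp hVd.continuous).continuousAt.comp hc.continuousAt).eventually_ne hL
  filter_upwards [h4, hγ.1.continuous.continuousAt.eventually_mem
      ((chartAt H (γ t₀)).open_source.mem_nhds (mem_chart_source H (γ t₀)))] with t ht ht'
  have h5 := hP.deriv_extChartAt_comp hV hγ.1 (by simp) ht' (hr t).symm
  have h6 : fderiv ℝ c t 1 = r t • V (c t) := h5.deriv
  rw [h6, map_smul, smul_eq_mul, mul_div_assoc, div_self ht, mul_one]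

variable (hn : 1 ≤ n)
include hn

/-- A tangent curve solves `c' = r(t) V(c)`. The orbit run at time `A = ∫ r` solves the same
equation with the same initial value, so the two agree near `t₀`. -/
theorem eventually_mem_range_flow {γ : ℝ → M} (hγ : (hP.foliation hV hVd hV0).IsTangentCurve γ)
    (t₀ : ℝ) : ∀ᶠ t in 𝓝 t₀, γ t ∈ range (P ∘ Φ (extChartAt I (γ t₀) (γ t₀))) := by
  obtain ⟨r, hr, hγr⟩ := hP.exists_continuous_speed hV hVd hV0 hγ
  have hc : ContDiffAt ℝ ∞ (extChartAt I (γ t₀) ∘ γ) t₀ :=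
    ((contMDiffAt_extChartAt (n := ∞)).comp t₀ hγ.1.contMDiffAt).contDiffAt
  have hsrc := hγ.1.continuous.continuousAt.eventually_mem
      ((chartAt H (γ t₀)).open_source.mem_nhds (mem_chart_source H (γ t₀)))
  have hP' : ∀ᶠ t in 𝓝 t₀, P ((extChartAt I (γ t₀) ∘ γ) t) = γ t := by
    filter_upwards [hsrc] with t ht using hP.apply_extChartAt ht
  have hc' : ∀ᶠ t in 𝓝 t₀, HasDerivAt (extChartAt I (γ t₀) ∘ γ)
      (r t • V ((extChartAt I (γ t₀) ∘ γ) t)) t := by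
    filter_upwards [hsrc] with t ht
    exact hP.deriv_extChartAt_comp hV hγ.1 (by simp) ht (hγr t)
  change ∀ᶠ t in 𝓝 t₀, γ t ∈ range (P ∘ Φ ((extChartAt I (γ t₀) ∘ γ) t₀))
  set c := extChartAt I (γ t₀) ∘ γ
  set A : ℝ → ℝ := fun t => ∫ s in t₀..t, r s
  have hA : ∀ t, HasDerivAt A (r t) t := fun t => hr.integral_hasStrictDerivAt t₀ t |>.hasDerivAt
  have hA0 : A t₀ = 0 := intervalIntegral.integral_same
  obtain ⟨K, s, hs, hK⟩ := (hVd.of_le hn).contDiffAt.exists_lipschitzOnWith (x := c t₀)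
  have hg : ∀ t, HasDerivAt (Φ (c t₀) ∘ A) (r t • V ((Φ (c t₀) ∘ A) t)) t := fun t =>
    (hΦ.hasDerivAt (c t₀) (A t)).scomp t (hA t)
  have hgc : (Φ (c t₀) ∘ A) t₀ = c t₀ := by simp [hA0, hΦ.apply_zero]
  have key : c =ᶠ[𝓝 t₀] Φ (c t₀) ∘ A := by
    -- Near `t₀` one has `|r t| < |r t₀| + 1`, which makes the Lipschitz constant uniform in `t`.
    refine ODE_solution_unique_of_eventually (v := fun t y => r t • V y) (s := fun _ => s)
      (K := (‖r t₀‖₊ + 1) * K) ?_ ?_ ?_ hgc.symm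
    · have : ∀ᶠ t in 𝓝 t₀, ‖r t‖₊ < ‖r t₀‖₊ + 1 :=
        hr.nnnorm.continuousAt.eventually_lt_const (by simp)
      filter_upwards [this] with t ht
      refine LipschitzOnWith.weaken ((lipschitzWith_smul (r t)).comp_lipschitzOnWith hK) ?_
      gcongr
    · exact hc'.and (hc.continuousAt.eventually_mem hs)
    · refine Eventually.and (Eventually.of_forall hg) ?_
      refine (hg t₀).continuousAt.eventually_mem ?_
      rwa [hgc]
  filter_upwards [key, hP'] with t h1 h2
  exact ⟨A t, by rw [← h2, h1]; rfl⟩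

variable [T2Space M]

/-- The times at which a tangent curve lies on a given orbit form an open set; so do the remaining
times, since orbits are equal or disjoint. The line is connected. -/
theorem leaf_eq_range (p : E) :
    (hP.foliation hV hVd hV0).leaf (P p) = range (P ∘ Φ p) := by
  apply Subset.antisymm
  · rintro y ⟨γ, hγ, a, b, ha, rfl⟩
    have hloc := hP.eventually_mem_range_flow hV hVd hV0 hΦ hn hγ
    have hself : ∀ t, P (Φ (extChartAt I (γ t) (γ t)) 0) = γ t := fun t => by
      rw [hΦ.apply_zero, hP.extChartAt_self]
    have hclopen : IsClopen {t | γ t ∈ range (P ∘ Φ p)} := by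
      refine ⟨isOpen_compl_iff.1 (isOpen_iff_mem_nhds.2 fun t ht => ?_),
        isOpen_iff_mem_nhds.2 fun t ht => ?_⟩
      · filter_upwards [hloc t] with s ⟨u, hu⟩ ⟨v, hv⟩
        have h := hP.range_flow_eq hV hΦ hVd hn (hu.trans hv.symm)
        exact ht (h ▸ ⟨0, hself t⟩)
      · obtain ⟨v, hv⟩ := ht
        have h := hP.range_flow_eq hV hΦ hVd hn ((hself t).trans hv.symm)
        filter_upwards [hloc t] with s hs
        exact h ▸ hs
    have hmem : a ∈ {t | γ t ∈ range (P ∘ Φ p)} := ⟨0, by simp [hΦ.apply_zero, ha]⟩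
    have huniv := hclopen.eq_univ ⟨a, hmem⟩
    exact (huniv.symm ▸ mem_univ b : b ∈ {t | γ t ∈ range (P ∘ Φ p)})
  · rintro _ ⟨t, rfl⟩
    exact ⟨P ∘ Φ p, hP.isTangentCurve_flow hV hVd hV0 hΦ p, 0, t, by simp [hΦ.apply_zero], rfl⟩

theorem isCircleParam_flow (p : E) :
    (hP.foliation hV hVd hV0).IsCircleParam (P p) (P ∘ Φ p) (T p) where
  tangent := hP.isTangentCurve_flow hV hVd hV0 hΦ p
  velocity_ne_zero t := by
    rw [hP.velocity_flow hV hΦ]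
    exact hV0 (extChartAt I ((P ∘ Φ p) t) ((P ∘ Φ p) t))
  period_pos := hΦ.period_pos p
  periodic := hΦ.periodic p
  injOn := hΦ.injOn p
  range_eq := (hP.leaf_eq_range hV hVd hV0 hΦ hn p).symm

theorem isByCircles : (hP.foliation hV hVd hV0).IsByCircles := fun x =>
  ⟨_, _, hP.extChartAt_self x ▸ hP.isCircleParam_flow hV hVd hV0 hΦ hn (extChartAt I x x)⟩

/-- By compactness `h(V, V)` has a positive minimum `m`, so a leaf of period `T` has length at least
`T √m`. -/
theorem unboundedLengthFor [CompactSpace M] [Nonempty M] (hT : ∀ C, ∃ p, C < T p)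
    (h : Bundle.ContMDiffRiemannianMetric I ∞ E (fun x : M => TangentSpace I x)) :
    (hP.foliation hV hVd hV0).UnboundedLengthFor h := by
  have hcont : Continuous fun x => h.inner x (descendField I V x) (descendField I V x) := by
    have h0 := hP.contMDiff_field hV (hVd.of_le (zero_le : (0 : ℕ∞ω) ≤ n))
    have h1 : ContMDiff I (I.prod 𝓘(ℝ, ℝ)) 0 fun x : M => Bundle.TotalSpace.mk' ℝ
        (E := Bundle.Trivial M ℝ) x (h.inner x (descendField I V x) (descendField I V x)) :=
      ContMDiff.clm_bundle_apply₂ (F₁ := E) (F₂ := E) (h.contMDiff.of_le (by simp)) h0 h0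
    exact (continuous_iff_continuousAt.2 fun x =>
      ((Bundle.contMDiffAt_section x).1 (h1 x)).continuousAt)
  obtain ⟨x₀, -, hx₀⟩ := isCompact_univ.exists_isMinOn univ_nonempty hcont.continuousOn
  set m := h.inner x₀ (descendField I V x₀) (descendField I V x₀)
  have hm : 0 < m := h.pos x₀ _ (hV0 (extChartAt I x₀ x₀))
  intro C
  obtain ⟨p, hp⟩ := hT (C / √m)
  refine ⟨P p, P ∘ Φ p, T p, hP.isCircleParam_flow hV hVd hV0 hΦ hn p, ?_⟩
  simp only [hP.velocity_flow hV hΦ]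
  calc C < T p * √m := (div_lt_iff₀ (Real.sqrt_pos.2 hm)).1 hp
    _ = ∫ t in (0 : ℝ)..T p, √m := by simp
    _ ≤ _ := by
      refine intervalIntegral.integral_mono_on (hΦ.period_pos p).le (by simp) ?_ ?_
      · exact ((hcont.comp (hP.contMDiff_flow hΦ p).continuous).sqrt).intervalIntegrable _ _
      · intro t _
        exact Real.sqrt_le_sqrt (hx₀ (mem_univ _))

end IsChartCover
end ChartCover

/-! ### The universal cover, its deck transformations, and compactness -/

namespace Heisenberg

@[simp] theorem x_add (p q : Heisenberg) : (p + q).x = p.x + q.x := rfl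
@[simp] theorem y_add (p q : Heisenberg) : (p + q).y = p.y + q.y := rfl
@[simp] theorem z_add (p q : Heisenberg) : (p + q).z = p.z + q.z := rfl
@[simp] theorem x_zero : (0 : Heisenberg).x = 0 := rfl
@[simp] theorem y_zero : (0 : Heisenberg).y = 0 := rfl
@[simp] theorem z_zero : (0 : Heisenberg).z = 0 := rfl

theorem hasDerivAt_mk {f g h : ℝ → ℝ} {f' g' h' t : ℝ} (hf : HasDerivAt f f' t)
    (hg : HasDerivAt g g' t) (hh : HasDerivAt h h' t) :
    HasDerivAt (fun s => mk (f s) (g s) (h s)) (mk f' g' h') t :=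
  hf.prodMk (hg.prodMk hh)

theorem norm_le {p : Heisenberg} {r : ℝ} : ‖p‖ ≤ r ↔ |p.x| ≤ r ∧ |p.y| ≤ r ∧ |p.z| ≤ r := by
  change max |p.x| (max |p.y| |p.z|) ≤ r ↔ _
  simp

theorem contDiff_mk_of {E : Type*} [NormedAddCommGroup E] [NormedSpace ℝ E] {n : ℕ∞ω}
    {f g h : E → ℝ} (hf : ContDiff ℝ n f) (hg : ContDiff ℝ n g) (hh : ContDiff ℝ n h) :
    ContDiff ℝ n (fun e => mk (f e) (g e) (h e)) :=
  (hf.prodMk (hg.prodMk hh) : ContDiff ℝ n (fun e => ((f e, g e, h e) : ℝ × ℝ × ℝ)))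

end Heisenberg

open Heisenberg

theorem IsLocalHomeomorph.chartAt_symm {H Q : Type*} [TopologicalSpace H] [TopologicalSpace Q]
    {f : H → Q} (hf : IsLocalHomeomorph f) (hs : Function.Surjective f) (q : Q) :
    ⇑(@chartAt H _ Q _ (hf.chartedSpace hs) q).symm = f := by
  ext z
  change (hf.localInverseAt (hs.hasRightInverse.choose q)).symm z = f z
  rw [hf.localInverseAt_symm]

/-- The universal cover of `N × S¹ × S¹`. -/
abbrev ThurstonCover : Type := Heisenberg × ℝ × ℝ

/-- The covering map of `N × S¹ × S¹`. -/
def thurstonProj (p : ThurstonCover) : ThurstonManifold :=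
  (Quotient.mk _ p.1, (p.2.1 : Circ), (p.2.2 : Circ))

/-- The deck transformation given by a lattice element and two integers. -/
def deckMap (γ : Heisenberg) (k l : ℤ) (p : ThurstonCover) : ThurstonCover :=
  (γ * p.1, p.2.1 + k * (2 * π), p.2.2 + l * (2 * π))

/-- The deck transformations of `thurstonProj`. -/
def deckMaps : Set (ThurstonCover → ThurstonCover) :=
  {τ | ∃ γ ∈ lattice, ∃ k l : ℤ, τ = deckMap γ k l}

theorem Nilmanifold.mk_eq_iff {p q : Heisenberg} :
    (Quotient.mk _ p : Nilmanifold) = Quotient.mk _ q ↔ ∃ γ ∈ lattice, γ * p = q := by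
  constructor
  · intro h
    obtain ⟨γ, hγ⟩ := Quotient.exact h.symm
    exact ⟨γ, γ.2, hγ⟩
  · rintro ⟨γ, hγ, rfl⟩
    exact (Quotient.sound ⟨⟨γ, hγ⟩, rfl⟩ : (Quotient.mk _ (γ * p) : Nilmanifold) = _).symm

theorem Circ.coe_eq_iff {s t : ℝ} : (s : Circ) = t ↔ ∃ k : ℤ, s + k * (2 * π) = t := by
  rw [eq_comm, ← sub_eq_zero, ← AddCircle.coe_sub, AddCircle.coe_eq_zero_iff]
  refine exists_congr fun k => ?_
  rw [zsmul_eq_mul, eq_sub_iff_add_eq, add_comm]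

theorem hasFDerivAt_deckMap (γ : Heisenberg) (k l : ℤ) (p : ThurstonCover) :
    HasFDerivAt (deckMap γ k l) (fderiv ℝ (deckMap γ k l) p) p ∧
    ∀ v, fderiv ℝ (deckMap γ k l) p v = (mk v.1.x v.1.y (v.1.z + γ.x * v.1.y), v.2) := by
  let L : ThurstonCover →ₗ[ℝ] ThurstonCover :=
    { toFun := fun v => (mk v.1.x v.1.y (v.1.z + γ.x * v.1.y), v.2)
      map_add' := fun v w => by
        refine Prod.ext (Heisenberg.ext rfl rfl ?_) rfl
        simp; ring
      map_smul' := fun a v => by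
        refine Prod.ext (Heisenberg.ext rfl rfl ?_) rfl
        change a * v.1.z + γ.x * (a * v.1.y) = a * (v.1.z + γ.x * v.1.y)
        ring }
  have h : HasFDerivAt (deckMap γ k l) (L.toContinuousLinearMap) p := by
    have h1 : deckMap γ k l = fun q => L.toContinuousLinearMap q +
        ((mk γ.x γ.y γ.z, k * (2 * π), l * (2 * π)) : ThurstonCover) := by
      ext q
      · change γ.x + q.1.x = q.1.x + γ.x
        ring
      · change γ.y + q.1.y = q.1.y + γ.y
        ring
      · change γ.z + q.1.z + γ.x * q.1.y = q.1.z + γ.x * q.1.y + γ.z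
        ring
      · rfl
      · rfl
    rw [h1]
    exact L.toContinuousLinearMap.hasFDerivAt.add_const _
  rw [h.fderiv]
  exact ⟨h, fun v => rfl⟩

theorem contDiff_deckMap (γ : Heisenberg) (k l : ℤ) : ContDiff ℝ ω (deckMap γ k l) := by
  refine ContDiff.prodMk ?_ (ContDiff.prodMk ?_ ?_)
  · exact contDiff_mul.comp (contDiff_const.prodMk contDiff_fst)
  · exact (contDiff_fst.comp contDiff_snd).add contDiff_const
  · exact (contDiff_snd.comp contDiff_snd).add contDiff_const

theorem isChartCover_thurstonProj : IsChartCover thurstonModel thurstonProj deckMaps where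
  extChartAt_symm x := by
    have h1 : ⇑(chartAt Heisenberg x.1).symm = fun p => (Quotient.mk _ p : Nilmanifold) :=
      IsLocalHomeomorph.chartAt_symm _ Quotient.mk_surjective _
    have h2 : ∀ y : Circ, ⇑(chartAt ℝ y).symm = fun t : ℝ => (t : Circ) := fun y =>
      IsLocalHomeomorph.chartAt_symm _ QuotientAddGroup.mk_surjective _
    ext p
    · exact congrFun h1 p.1
    · exact congrFun (h2 x.2.1) p.2.1
    · exact congrFun (h2 x.2.2) p.2.2
  contDiff := by
    rintro _ ⟨γ, -, k, l, rfl⟩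
    exact contDiff_deckMap γ k l
  apply_deck := by
    rintro _ ⟨γ, hγ, k, l, rfl⟩ p
    exact Prod.ext (Nilmanifold.mk_eq_iff.2 ⟨γ, hγ, rfl⟩).symm
      (Prod.ext (Circ.coe_eq_iff.2 ⟨k, rfl⟩).symm (Circ.coe_eq_iff.2 ⟨l, rfl⟩).symm)
  exists_deck p q h := by
    obtain ⟨γ, hγ, h1⟩ := Nilmanifold.mk_eq_iff.1 (congrArg Prod.fst h)
    obtain ⟨k, h2⟩ := Circ.coe_eq_iff.1 (congrArg (fun x => x.2.1) h)
    obtain ⟨l, h3⟩ := Circ.coe_eq_iff.1 (congrArg (fun x => x.2.2) h)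
    exact ⟨_, ⟨γ, hγ, k, l, rfl⟩, Prod.ext h1 (Prod.ext h2 h3)⟩

instance : Fact (0 < 2 * π) := ⟨Real.two_pi_pos⟩

instance : CompactSpace Nilmanifold := by
  let K : Set Heisenberg := (fun v : ℝ × ℝ × ℝ => mk v.1 v.2.1 v.2.2) ''
    (Icc 0 1 ×ˢ (Icc 0 1 ×ˢ Icc 0 1))
  have hK : IsCompact K := (isCompact_Icc.prod (isCompact_Icc.prod isCompact_Icc)).image
    (contDiff_mk contDiff_fst (contDiff_fst.comp contDiff_snd)
      (contDiff_snd.comp contDiff_snd)).continuous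
  have hq : Continuous fun p => (Quotient.mk _ p : Nilmanifold) := continuous_quotient_mk'
  refine ⟨?_⟩
  convert hK.image hq
  refine (eq_univ_of_forall fun y => ?_).symm
  obtain ⟨p, rfl⟩ := Quotient.mk_surjective y
  -- Left multiplication by an element with first entry `-⌊x⌋` also adds `-⌊x⌋ y` to `z`; `w` is
  -- what remains to be reduced modulo `1`.
  let w : ℝ := p.z - ⌊p.x⌋ * p.y
  refine ⟨mk (Int.fract p.x) (Int.fract p.y) (Int.fract w), ⟨(_, _, _), ⟨⟨Int.fract_nonneg _,
    (Int.fract_lt_one _).le⟩, ⟨Int.fract_nonneg _, (Int.fract_lt_one _).le⟩,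
    Int.fract_nonneg _, (Int.fract_lt_one _).le⟩, rfl⟩, ?_⟩
  refine (Nilmanifold.mk_eq_iff.2 ⟨mk ((-⌊p.x⌋ : ℤ) : ℝ) ((-⌊p.y⌋ : ℤ) : ℝ) ((-⌊w⌋ : ℤ) : ℝ),
    ⟨_, _, _, rfl⟩, ?_⟩).symm
  ext
  · simp [← Int.self_sub_floor]; ring
  · simp [← Int.self_sub_floor]; ring
  · simp [← Int.self_sub_floor, w]; ring

instance : ConnectedSpace Nilmanifold :=
  haveI : ConnectedSpace Heisenberg := inferInstanceAs (ConnectedSpace (ℝ × ℝ × ℝ))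
  inferInstanceAs (ConnectedSpace (Quotient _))

instance : ConnectedSpace Circ := inferInstanceAs (ConnectedSpace (ℝ ⧸ _))


/-! ### The vector field and the metric on the cover -/

/-- Three functions of the angle `u` that determine a circle foliation and a metric. -/
structure IsProfile (n : ℕ∞ω) (φ ψ σ : ℝ → ℝ) : Prop where
  one_le : 1 ≤ n
  contDiff_fst : ContDiff ℝ n φ
  contDiff_snd : ContDiff ℝ n ψ
  contDiff_trd : ContDiff ℝ n σ
  periodic_fst : Function.Periodic φ (2 * π)
  periodic_snd : Function.Periodic ψ (2 * π)
  periodic_trd : Function.Periodic σ (2 * π)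
  sq_add_sq : ∀ u, φ u ^ 2 + ψ u ^ 2 = 1
  -- Ensures nondegeneracy of the metric.
  lt_one : ∀ u, 2 * σ u * φ u ^ 2 < 1
  -- The geodesic equation: where `φ ≠ 0`, the ratio `σ / φ²` is locally constant.
  deriv_mul : ∀ u, deriv σ u * φ u ^ 2 = σ u * deriv (fun s => φ s ^ 2) u

namespace ThurstonCover

/-- The coordinate functions as continuous linear forms. -/
def dx : ThurstonCover →L[ℝ] ℝ :=
  LinearMap.toContinuousLinearMap
    { toFun := fun v => v.1.x, map_add' := fun _ _ => rfl, map_smul' := fun _ _ => rfl }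
def dy : ThurstonCover →L[ℝ] ℝ :=
  LinearMap.toContinuousLinearMap
    { toFun := fun v => v.1.y, map_add' := fun _ _ => rfl, map_smul' := fun _ _ => rfl }
def dz : ThurstonCover →L[ℝ] ℝ :=
  LinearMap.toContinuousLinearMap
    { toFun := fun v => v.1.z, map_add' := fun _ _ => rfl, map_smul' := fun _ _ => rfl }
def dt : ThurstonCover →L[ℝ] ℝ :=
  LinearMap.toContinuousLinearMap
    { toFun := fun v => v.2.1, map_add' := fun _ _ => rfl, map_smul' := fun _ _ => rfl }
def du : ThurstonCover →L[ℝ] ℝ :=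
  LinearMap.toContinuousLinearMap
    { toFun := fun v => v.2.2, map_add' := fun _ _ => rfl, map_smul' := fun _ _ => rfl }

@[simp] theorem dx_apply (v : ThurstonCover) : dx v = v.1.x := rfl
@[simp] theorem dy_apply (v : ThurstonCover) : dy v = v.1.y := rfl
@[simp] theorem dz_apply (v : ThurstonCover) : dz v = v.1.z := rfl
@[simp] theorem dt_apply (v : ThurstonCover) : dt v = v.2.1 := rfl
@[simp] theorem du_apply (v : ThurstonCover) : du v = v.2.2 := rfl

/-- The invariant form `dz - x dy`. -/
def contactForm (p : ThurstonCover) : ThurstonCover →L[ℝ] ℝ := dz - p.1.x • dy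

@[simp] theorem contactForm_apply (p v : ThurstonCover) :
    contactForm p v = v.1.z - p.1.x * v.1.y := rfl

variable (φ ψ σ : ℝ → ℝ)

/-- The vector field `2φψ (cos t X + sin t Y) - ψ² Z + 2φ² ∂_t`, where `X = ∂_x`,
`Y = ∂_y + x ∂_z`, `Z = ∂_z` are the left invariant fields. -/
def field (p : ThurstonCover) : ThurstonCover :=
  (mk (2 * φ p.2.2 * ψ p.2.2 * Real.cos p.2.1) (2 * φ p.2.2 * ψ p.2.2 * Real.sin p.2.1)
    (p.1.x * (2 * φ p.2.2 * ψ p.2.2 * Real.sin p.2.1) - ψ p.2.2 ^ 2), 2 * φ p.2.2 ^ 2, 0)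

/-- The form dual to `field` for the metric `riemannForm`. -/
def dualForm (p : ThurstonCover) : ThurstonCover →L[ℝ] ℝ :=
  (φ p.2.2 * ψ p.2.2 * Real.cos p.2.1) • dx + (φ p.2.2 * ψ p.2.2 * Real.sin p.2.1) • dy
    - ψ p.2.2 ^ 2 • contactForm p + (φ p.2.2 ^ 2 / 2) • dt

/-- The Riemannian metric `(dx² + dy²)/2 + (dz - x dy)² + dt²/4 + du²`. -/
def riemannForm (p : ThurstonCover) : ThurstonCover →L[ℝ] ThurstonCover →L[ℝ] ℝ :=
  (1 / 2 : ℝ) • dx.smulRight dx + (1 / 2 : ℝ) • dy.smulRight dy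
    + (contactForm p).smulRight (contactForm p) + (1 / 4 : ℝ) • dt.smulRight dt + du.smulRight du

/-- A pseudo-Riemannian metric for which `field` is dual to `du + σ dt`. -/
def metricForm (p : ThurstonCover) : ThurstonCover →L[ℝ] ThurstonCover →L[ℝ] ℝ :=
  riemannForm p - ((1 + 2 * σ p.2.2 * φ p.2.2 ^ 2) • dualForm φ ψ p).smulRight (dualForm φ ψ p)
    + du.smulRight (dualForm φ ψ p) + (dualForm φ ψ p).smulRight du
    + ((σ p.2.2 • dualForm φ ψ p).smulRight dt + dt.smulRight (σ p.2.2 • dualForm φ ψ p))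

theorem dualForm_apply (p v : ThurstonCover) : dualForm φ ψ p v =
    φ p.2.2 * ψ p.2.2 * Real.cos p.2.1 * v.1.x + φ p.2.2 * ψ p.2.2 * Real.sin p.2.1 * v.1.y
      - ψ p.2.2 ^ 2 * (v.1.z - p.1.x * v.1.y) + φ p.2.2 ^ 2 / 2 * v.2.1 := rfl

theorem riemannForm_apply (p v w : ThurstonCover) : riemannForm p v w =
    1 / 2 * (v.1.x * w.1.x) + 1 / 2 * (v.1.y * w.1.y)
      + (v.1.z - p.1.x * v.1.y) * (w.1.z - p.1.x * w.1.y) + 1 / 4 * (v.2.1 * w.2.1)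
      + v.2.2 * w.2.2 := rfl

theorem metricForm_apply (p v w : ThurstonCover) : metricForm φ ψ σ p v w =
    riemannForm p v w
      - (1 + 2 * σ p.2.2 * φ p.2.2 ^ 2) * (dualForm φ ψ p v * dualForm φ ψ p w)
      + v.2.2 * dualForm φ ψ p w + dualForm φ ψ p v * w.2.2
      + σ p.2.2 * (dualForm φ ψ p v * w.2.1 + v.2.1 * dualForm φ ψ p w) := by
  change riemannForm p v w
      - ((1 + 2 * σ p.2.2 * φ p.2.2 ^ 2) * dualForm φ ψ p v) * dualForm φ ψ p w
      + v.2.2 * dualForm φ ψ p w + dualForm φ ψ p v * w.2.2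
      + ((σ p.2.2 * dualForm φ ψ p v) * w.2.1 + v.2.1 * (σ p.2.2 * dualForm φ ψ p w)) = _
  ring

theorem riemannForm_symm (p v w : ThurstonCover) : riemannForm p v w = riemannForm p w v := by
  simp only [riemannForm_apply]; ring

theorem metricForm_symm (p v w : ThurstonCover) :
    metricForm φ ψ σ p v w = metricForm φ ψ σ p w v := by
  simp only [metricForm_apply, riemannForm_symm p v w]; ring

theorem riemannForm_pos (p : ThurstonCover) {v : ThurstonCover} (hv : v ≠ 0) :
    0 < riemannForm p v v := by
  by_contra! h
  rw [riemannForm_apply] at h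
  have h1 := mul_self_nonneg v.1.x
  have h2 := mul_self_nonneg v.1.y
  have h3 := mul_self_nonneg (v.1.z - p.1.x * v.1.y)
  have h4 := mul_self_nonneg v.2.1
  have h5 := mul_self_nonneg v.2.2
  have e1 : v.1.x = 0 := mul_self_eq_zero.1 (by linarith)
  have e2 : v.1.y = 0 := mul_self_eq_zero.1 (by linarith)
  have e3 : v.1.z - p.1.x * v.1.y = 0 := mul_self_eq_zero.1 (by linarith)
  have e4 : v.2.1 = 0 := mul_self_eq_zero.1 (by linarith)
  have e5 : v.2.2 = 0 := mul_self_eq_zero.1 (by linarith)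
  rw [e2, mul_zero, sub_zero] at e3
  exact hv (Prod.ext (Heisenberg.ext e1 e2 e3) (Prod.ext e4 e5))

/-- Supplies the boundedness of unit balls that a Riemannian metric on the bundle requires. The
bound depends on the point through `dz - x dy`. -/
theorem norm_le_of_riemannForm_lt_one {p v : ThurstonCover} (h : riemannForm p v v < 1) :
    ‖v‖ ≤ 2 + 2 * |p.1.x| := by
  rw [riemannForm_apply] at h
  have h1 := mul_self_nonneg v.1.x
  have h2 := mul_self_nonneg v.1.y
  have h3 := mul_self_nonneg (v.1.z - p.1.x * v.1.y)
  have h4 := mul_self_nonneg v.2.1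
  have h5 := mul_self_nonneg v.2.2
  have e1 : |v.1.x| ≤ 2 := abs_le_of_sq_le_sq (by linarith) (by norm_num)
  have e2 : |v.1.y| ≤ 2 := abs_le_of_sq_le_sq (by linarith) (by norm_num)
  have e3 : |v.1.z - p.1.x * v.1.y| ≤ 2 := abs_le_of_sq_le_sq (by linarith) (by norm_num)
  have e4 : |v.2.1| ≤ 2 := abs_le_of_sq_le_sq (by linarith) (by norm_num)
  have e5 : |v.2.2| ≤ 2 := abs_le_of_sq_le_sq (by linarith) (by norm_num)
  have e6 : |v.1.z| ≤ 2 + 2 * |p.1.x| := by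
    have := abs_add_le (v.1.z - p.1.x * v.1.y) (p.1.x * v.1.y)
    rw [sub_add_cancel, abs_mul] at this
    nlinarith [mul_le_mul_of_nonneg_left e2 (abs_nonneg p.1.x)]
  have e7 := abs_nonneg p.1.x
  refine max_le (Heisenberg.norm_le.2 ⟨?_, ?_, e6⟩) (max_le ?_ ?_)
  · linarith
  · linarith
  · exact e4.trans (by linarith)
  · exact e5.trans (by linarith)

variable {φ ψ σ}

theorem isInvariantForm_riemannForm : IsInvariantForm deckMaps riemannForm := by
  rintro _ ⟨γ, -, k, l, rfl⟩ p v w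
  simp only [(hasFDerivAt_deckMap γ k l p).2, riemannForm_apply, deckMap, x_mul, x_mk, y_mk, z_mk]
  ring

theorem contDiff_contactForm {n : ℕ∞ω} : ContDiff ℝ n contactForm :=
  contDiff_const.sub (dx.contDiff.smul contDiff_const)

theorem contDiff_riemannForm {n : ℕ∞ω} : ContDiff ℝ n riemannForm :=
  (((contDiff_const.add contDiff_const).add
    (contDiff_contactForm.smulRight contDiff_contactForm)).add contDiff_const).add contDiff_const

end ThurstonCover

namespace IsProfile

open ThurstonCover

variable {n : ℕ∞ω} {φ ψ σ : ℝ → ℝ} (h : IsProfile n φ ψ σ)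
include h

theorem isInvariantField : IsInvariantField deckMaps (field φ ψ) := by
  rintro _ ⟨γ, -, k, l, rfl⟩ p
  have h1 := h.periodic_fst.int_mul l p.2.2
  have h2 := h.periodic_snd.int_mul l p.2.2
  rw [(hasFDerivAt_deckMap γ k l p).2]
  simp only [field, deckMap, h1, h2, Real.cos_add_int_mul_two_pi, Real.sin_add_int_mul_two_pi,
    x_mul, x_mk, y_mk, z_mk]
  refine Prod.ext (Heisenberg.ext rfl rfl ?_) rfl
  simp only [z_mk]
  ring

theorem isInvariantForm : IsInvariantForm deckMaps (metricForm φ ψ σ) := by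
  rintro _ ⟨γ, hγ, k, l, rfl⟩ p v w
  have h1 := h.periodic_fst.int_mul l p.2.2
  have h2 := h.periodic_snd.int_mul l p.2.2
  have h3 := h.periodic_trd.int_mul l p.2.2
  have h4 := isInvariantForm_riemannForm _ ⟨γ, hγ, k, l, rfl⟩ p v w
  have h5 : ∀ v, dualForm φ ψ (deckMap γ k l p) (fderiv ℝ (deckMap γ k l) p v)
      = dualForm φ ψ p v := by
    intro v
    rw [(hasFDerivAt_deckMap γ k l p).2]
    simp only [dualForm_apply, deckMap, h1, h2, Real.cos_add_int_mul_two_pi,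
      Real.sin_add_int_mul_two_pi, x_mul, x_mk, y_mk, z_mk]
    ring
  simp only [metricForm_apply, h4, h5]
  simp only [(hasFDerivAt_deckMap γ k l p).2, deckMap, h1, h3]

theorem contDiff_field : ContDiff ℝ n (field φ ψ) := by
  have h1 : ContDiff ℝ n fun p : ThurstonCover => φ p.2.2 := h.contDiff_fst.comp du.contDiff
  have h2 : ContDiff ℝ n fun p : ThurstonCover => ψ p.2.2 := h.contDiff_snd.comp du.contDiff
  have hc : ContDiff ℝ n fun p : ThurstonCover => Real.cos p.2.1 :=
    Real.contDiff_cos.comp dt.contDiff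
  have hs : ContDiff ℝ n fun p : ThurstonCover => Real.sin p.2.1 :=
    Real.contDiff_sin.comp dt.contDiff
  have hx : ContDiff ℝ n fun p : ThurstonCover => p.1.x := dx.contDiff
  have h3 := (contDiff_const (c := (2 : ℝ))).mul h1
  exact (contDiff_mk_of ((h3.mul h2).mul hc) ((h3.mul h2).mul hs)
    ((hx.mul ((h3.mul h2).mul hs)).sub (h2.pow 2))).prodMk
    ((contDiff_const.mul (h1.pow 2)).prodMk contDiff_const)

theorem contDiff_metricForm : ContDiff ℝ n (metricForm φ ψ σ) := by
  have h1 : ContDiff ℝ n fun p : ThurstonCover => φ p.2.2 := h.contDiff_fst.comp du.contDiff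
  have h2 : ContDiff ℝ n fun p : ThurstonCover => ψ p.2.2 := h.contDiff_snd.comp du.contDiff
  have h3 : ContDiff ℝ n fun p : ThurstonCover => σ p.2.2 := h.contDiff_trd.comp du.contDiff
  have hc : ContDiff ℝ n fun p : ThurstonCover => Real.cos p.2.1 :=
    Real.contDiff_cos.comp dt.contDiff
  have hs : ContDiff ℝ n fun p : ThurstonCover => Real.sin p.2.1 :=
    Real.contDiff_sin.comp dt.contDiff
  have hd : ContDiff ℝ n (dualForm φ ψ) :=
    (((((h1.mul h2).mul hc).smul contDiff_const).add (((h1.mul h2).mul hs).smul contDiff_const)).sub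
      ((h2.pow 2).smul contDiff_contactForm)).add (((h1.pow 2).div_const 2).smul contDiff_const)
  have hf : ContDiff ℝ n fun p : ThurstonCover => 1 + 2 * σ p.2.2 * φ p.2.2 ^ 2 :=
    contDiff_const.add ((contDiff_const.mul h3).mul (h1.pow 2))
  have hσ : ContDiff ℝ n fun p => σ p.2.2 • dualForm φ ψ p := h3.smul hd
  have e1 : ContDiff ℝ n fun p : ThurstonCover =>
    ((1 + 2 * σ p.2.2 * φ p.2.2 ^ 2) • dualForm φ ψ p).smulRight (dualForm φ ψ p) :=
    (hf.smul hd).smulRight hd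
  have e2 : ContDiff ℝ n fun p =>
    (σ p.2.2 • dualForm φ ψ p).smulRight dt + dt.smulRight (σ p.2.2 • dualForm φ ψ p) :=
    (hσ.smulRight contDiff_const).add (contDiff_const.smulRight hσ)
  have e3 : ContDiff ℝ n fun p => du.smulRight (dualForm φ ψ p) := contDiff_const.smulRight hd
  have e4 : ContDiff ℝ n fun p => (dualForm φ ψ p).smulRight du := hd.smulRight contDiff_const
  exact (((contDiff_riemannForm.sub e1).add e3).add e4).add e2

theorem field_ne_zero (p : ThurstonCover) : field φ ψ p ≠ 0 := by
  intro h0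
  have h1 : 2 * φ p.2.2 ^ 2 = 0 := congrArg (fun v : ThurstonCover => v.2.1) h0
  have h2 : 2 * φ p.2.2 * ψ p.2.2 * Real.sin p.2.1 = 0 :=
    congrArg (fun v : ThurstonCover => v.1.y) h0
  have h3 : p.1.x * (2 * φ p.2.2 * ψ p.2.2 * Real.sin p.2.1) - ψ p.2.2 ^ 2 = 0 :=
    congrArg (fun v : ThurstonCover => v.1.z) h0
  rw [h2] at h3
  have h4 := h.sq_add_sq p.2.2
  linarith

/-- `2φ²ψ² + ψ⁴ + φ⁴ = (φ² + ψ²)² - 0 = 1`, the first term coming from `2φ²ψ² (cos² t + sin² t)`. -/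
theorem dualForm_field (p : ThurstonCover) : dualForm φ ψ p (field φ ψ p) = 1 := by
  rw [dualForm_apply]
  simp only [field, x_mk, y_mk, z_mk]
  have h1 := h.sq_add_sq p.2.2
  have h2 := Real.sin_sq_add_cos_sq p.2.1
  linear_combination (2 * φ p.2.2 ^ 2 * ψ p.2.2 ^ 2) * h2
    + (φ p.2.2 ^ 2 + ψ p.2.2 ^ 2 + 1) * h1

omit h in
theorem riemannForm_field (p w : ThurstonCover) :
    riemannForm p (field φ ψ p) w = dualForm φ ψ p w := by
  rw [dualForm_apply, riemannForm_apply]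
  simp only [field, x_mk, y_mk, z_mk]
  ring

/-- Since `α(V) = 1`, `du(V) = 0` and `dt(V) = 2φ²`, the multiples of `α` cancel: `1 - (1 + 2σφ²) +
2σφ² = 0`. -/
theorem metricForm_field (p w : ThurstonCover) :
    metricForm φ ψ σ p (field φ ψ p) w = w.2.2 + σ p.2.2 * w.2.1 := by
  rw [metricForm_apply, h.dualForm_field, riemannForm_field]
  simp only [field]
  ring

/-- Let `a = α(v)`. Testing against `V`, `∂_u` and `v` gives `du(v) + σ dt(v) = 0`, `du(v) = -a` and
`k(v, v) = (1 + 2σφ²) a²`. Since `V`, `∂_u` are `k`-orthonormal, `k(v, v) ≥ a² + du(v)² = 2a²`; as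
`2σφ² < 1`, this forces `a = 0`, then `v = 0`. -/
theorem metricForm_nondegenerate (p v : ThurstonCover) (hv : ∀ w, metricForm φ ψ σ p v w = 0) :
    v = 0 := by
  have h1 := hv (field φ ψ p)
  rw [metricForm_symm, h.metricForm_field] at h1
  have h2 := hv (0, 0, 1)
  rw [metricForm_apply, riemannForm_apply, dualForm_apply φ ψ p (0, 0, 1)] at h2
  simp at h2
  have h3 := hv v
  rw [metricForm_apply] at h3
  have h4 : 0 ≤ riemannForm p (v - dualForm φ ψ p v • field φ ψ p - v.2.2 • (0, 0, 1))
      (v - dualForm φ ψ p v • field φ ψ p - v.2.2 • (0, 0, 1)) := by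
    by_cases h5 : v - dualForm φ ψ p v • field φ ψ p - v.2.2 • (0, 0, 1) = 0
    · rw [h5]; simp
    · exact (riemannForm_pos p h5).le
  have h6 : riemannForm p (v - dualForm φ ψ p v • field φ ψ p - v.2.2 • (0, 0, 1))
      (v - dualForm φ ψ p v • field φ ψ p - v.2.2 • (0, 0, 1))
      = riemannForm p v v - dualForm φ ψ p v ^ 2 - v.2.2 ^ 2 := by
    have e1 : ∀ w, riemannForm p w (0, 0, 1) = w.2.2 := by
      intro w; rw [riemannForm_apply]; simp
    have e2 : riemannForm p v (field φ ψ p) = dualForm φ ψ p v := by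
      rw [riemannForm_symm, riemannForm_field]
    have e3 : ∀ w : ThurstonCover, riemannForm p (0, 0, 1) w = w.2.2 := by
      intro w; rw [riemannForm_symm, e1]
    have e4 : (field φ ψ p).2.2 = 0 := rfl
    simp only [map_sub, map_smul, sub_apply, smul_apply,
      riemannForm_field, h.dualForm_field, e1, e2, e3, e4, smul_eq_mul]
    ring
  rw [h6] at h4
  set a := dualForm φ ψ p v
  have hb : v.2.2 = -a := by linarith
  have hR : riemannForm p v v = (1 + 2 * σ p.2.2 * φ p.2.2 ^ 2) * a ^ 2 := by
    linear_combination h3 - 2 * a * h1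
  rw [hR, hb] at h4
  have ha : a = 0 := by
    by_contra ha
    have h7 : 0 < (1 - 2 * σ p.2.2 * φ p.2.2 ^ 2) * a ^ 2 :=
      mul_pos (by linarith [h.lt_one p.2.2]) (by positivity)
    linarith
  by_contra hv0
  have h8 := riemannForm_pos p hv0
  rw [hR, ha] at h8
  simp at h8

end IsProfile

/-! ### Explicit flow and closing of the orbits -/

namespace ThurstonCover

/-- The flow of `field` on the set `φ ≠ 0`. -/
def circularFlow (φ ψ : ℝ → ℝ) (p : ThurstonCover) (s : ℝ) : ThurstonCover :=
  let r := ψ p.2.2 / φ p.2.2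
  let t := p.2.1 + 2 * φ p.2.2 ^ 2 * s
  (mk (p.1.x + r * (Real.sin t - Real.sin p.2.1)) (p.1.y - r * (Real.cos t - Real.cos p.2.1))
    (p.1.z - (p.1.x - r * Real.sin p.2.1) * (r * (Real.cos t - Real.cos p.2.1))
      - r ^ 2 / 4 * (Real.sin (2 * t) - Real.sin (2 * p.2.1))), t, p.2.2)

/-- The flow of `field` on the set `φ = 0`. -/
def verticalFlow (p : ThurstonCover) (s : ℝ) : ThurstonCover :=
  (mk p.1.x p.1.y (p.1.z - s), p.2)

open Classical in
/-- The flow of `field`. -/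
def flow (φ ψ : ℝ → ℝ) (p : ThurstonCover) : ℝ → ThurstonCover :=
  if φ p.2.2 = 0 then verticalFlow p else circularFlow φ ψ p

open Classical in
/-- The period in `N × S¹ × S¹` of the orbits of `field`. -/
def period (φ : ℝ → ℝ) (p : ThurstonCover) : ℝ :=
  if φ p.2.2 = 0 then 1 else π / φ p.2.2 ^ 2

theorem flow_snd_snd (φ ψ : ℝ → ℝ) (p : ThurstonCover) (s : ℝ) : (flow φ ψ p s).2.2 = p.2.2 := by
  unfold flow
  split_ifs <;> rfl

theorem contDiff_circularFlow (φ ψ : ℝ → ℝ) (p : ThurstonCover) :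
    ContDiff ℝ ∞ (circularFlow φ ψ p) := by
  unfold circularFlow
  refine (contDiff_mk_of ?_ ?_ ?_).prodMk (ContDiff.prodMk ?_ contDiff_const) <;> fun_prop

theorem contDiff_verticalFlow (p : ThurstonCover) : ContDiff ℝ ∞ (verticalFlow p) := by
  unfold verticalFlow
  refine (contDiff_mk_of ?_ ?_ ?_).prodMk contDiff_const <;> fun_prop

/-- The decisive cancellation is in `z' = x y' - ψ²`: it contains `ψ² (2 sin² t - 1) = -ψ² cos 2t`,
so `z` acquires no term linear in time. -/
theorem hasDerivAt_circularFlow {φ ψ : ℝ → ℝ} {p : ThurstonCover} (hp : φ p.2.2 ≠ 0) (s : ℝ) :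
    HasDerivAt (circularFlow φ ψ p) (field φ ψ (circularFlow φ ψ p s)) s := by
  set a := φ p.2.2 with ha
  set b := ψ p.2.2 with hb
  set r := b / a with hr
  have hra : r * a = b := div_mul_cancel₀ b hp
  set t := fun s : ℝ => p.2.1 + 2 * a ^ 2 * s with htdef
  have ht : HasDerivAt t (2 * a ^ 2) s :=
    (((hasDerivAt_id s).const_mul (2 * a ^ 2)).const_add p.2.1).congr_deriv (mul_one _)
  have hsin := ht.sin
  have hcos := ht.cos
  have hsin2 := (ht.const_mul 2).sin
  have h1 := (((hsin.sub_const (Real.sin p.2.1)).const_mul r).const_add p.1.x)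
  have h2 := (((hcos.sub_const (Real.cos p.2.1)).const_mul r).const_sub p.1.y)
  have h3 := ((((hcos.sub_const (Real.cos p.2.1)).const_mul r).const_mul
    (p.1.x - r * Real.sin p.2.1)).const_sub p.1.z).sub
    ((hsin2.sub_const (Real.sin (2 * p.2.1))).const_mul (r ^ 2 / 4))
  have h4 := (hasDerivAt_mk h1 h2 h3).prodMk (ht.prodMk (hasDerivAt_const s p.2.2))
  refine h4.congr_deriv ?_
  have hc := Real.cos_two_mul' (t s)
  have hsc := Real.sin_sq_add_cos_sq (t s)
  refine Prod.ext (Heisenberg.ext ?_ ?_ ?_) rfl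
  · change r * (Real.cos (t s) * (2 * a ^ 2)) = 2 * a * b * Real.cos (t s)
    rw [← hra]; ring
  · change -(r * (-Real.sin (t s) * (2 * a ^ 2))) = 2 * a * b * Real.sin (t s)
    rw [← hra]; ring
  · change -((p.1.x - r * Real.sin p.2.1) * (r * (-Real.sin (t s) * (2 * a ^ 2))))
      - r ^ 2 / 4 * (Real.cos (2 * t s) * (2 * (2 * a ^ 2)))
      = (p.1.x + r * (Real.sin (t s) - Real.sin p.2.1)) * (2 * a * b * Real.sin (t s)) - b ^ 2
    rw [← hra, hc]
    linear_combination (-(r ^ 2 * a ^ 2)) * hsc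

/-- After `t` gains `2π` all other coordinates return already on the cover; only `t` needs the
quotient. -/
theorem periodic_circularFlow {φ ψ : ℝ → ℝ} {p : ThurstonCover} (hp : φ p.2.2 ≠ 0) :
    Function.Periodic (thurstonProj ∘ circularFlow φ ψ p) (π / φ p.2.2 ^ 2) := by
  intro s
  have h1 : p.2.1 + 2 * φ p.2.2 ^ 2 * (s + π / φ p.2.2 ^ 2)
      = p.2.1 + 2 * φ p.2.2 ^ 2 * s + 2 * π := by
    field_simp
    ring
  have h2 : ∀ a : ℝ, Real.sin (2 * (a + 2 * π)) = Real.sin (2 * a) := fun a => by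
    rw [mul_add, two_mul (2 * π), ← add_assoc, Real.sin_add_two_pi, Real.sin_add_two_pi]
  simp only [Function.comp_apply, circularFlow, h1, h2, Real.sin_add_two_pi, Real.cos_add_two_pi]
  refine Prod.ext rfl (Prod.ext ?_ rfl)
  exact (Circ.coe_eq_iff.2 ⟨1, by simp⟩).symm

/-- The coordinate `t` alone separates times, gaining less than `2π` within one period. -/
theorem injOn_circularFlow {φ ψ : ℝ → ℝ} {p : ThurstonCover} (hp : φ p.2.2 ≠ 0) :
    InjOn (thurstonProj ∘ circularFlow φ ψ p) (Ico 0 (π / φ p.2.2 ^ 2)) := by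
  intro s hs s' hs' h
  obtain ⟨k, hk⟩ := Circ.coe_eq_iff.1 (congrArg (fun x => x.2.1) h)
  change p.2.1 + 2 * φ p.2.2 ^ 2 * s + k * (2 * π) = p.2.1 + 2 * φ p.2.2 ^ 2 * s' at hk
  have ha : 0 < φ p.2.2 ^ 2 := by positivity
  have hs1 := (lt_div_iff₀ ha).1 hs.2
  have hs2 := (lt_div_iff₀ ha).1 hs'.2
  have hs3 := mul_nonneg hs.1 ha.le
  have hs4 := mul_nonneg hs'.1 ha.le
  have hk1 : |(k : ℝ)| < 1 := by
    rw [abs_lt]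
    constructor <;> nlinarith [Real.pi_pos]
  have hk0 : k = 0 := Int.abs_lt_one_iff.1 (by exact_mod_cast hk1)
  rw [hk0] at hk
  refine mul_left_cancel₀ ha.ne' ?_
  push_cast at hk
  linarith

theorem periodic_verticalFlow (p : ThurstonCover) :
    Function.Periodic (thurstonProj ∘ verticalFlow p) 1 := by
  intro s
  refine Prod.ext ?_ rfl
  refine (Nilmanifold.mk_eq_iff.2 ⟨mk ((0 : ℤ) : ℝ) ((0 : ℤ) : ℝ) ((-1 : ℤ) : ℝ), ⟨_, _, _, rfl⟩,
    ?_⟩).symm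
  ext <;> simp [verticalFlow]
  ring

/-- A lattice element that preserves `x` shifts `z` by an integer, here of absolute value less than
`1`. -/
theorem injOn_verticalFlow (p : ThurstonCover) :
    InjOn (thurstonProj ∘ verticalFlow p) (Ico 0 1) := by
  intro s hs s' hs' h
  obtain ⟨_, ⟨a, b, c, rfl⟩, hγ⟩ := Nilmanifold.mk_eq_iff.1 (congrArg Prod.fst h)
  have hx := congrArg Heisenberg.x hγ
  have hz := congrArg Heisenberg.z hγ
  simp only [verticalFlow, x_mul, z_mul, x_mk, y_mk, z_mk] at hx hz
  have ha : (a : ℝ) = 0 := by linarith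
  rw [ha] at hz
  have hc : |(c : ℝ)| < 1 := by
    rw [abs_lt]
    constructor <;> linarith [hs.1, hs.2, hs'.1, hs'.2]
  have hc0 : c = 0 := Int.abs_lt_one_iff.1 (by exact_mod_cast hc)
  rw [hc0] at hz
  push_cast at hz
  linarith

end ThurstonCover

/-! ### All orbits are circles and geodesics -/

namespace IsProfile

open ThurstonCover

variable {n : ℕ∞ω} {φ ψ σ : ℝ → ℝ} (h : IsProfile n φ ψ σ)
include h

theorem hasDerivAt_verticalFlow {p : ThurstonCover} (hp : φ p.2.2 = 0) (s : ℝ) :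
    HasDerivAt (verticalFlow p) (field φ ψ (verticalFlow p s)) s := by
  have h1 := (hasDerivAt_mk (hasDerivAt_const s p.1.x) (hasDerivAt_const s p.1.y)
    ((hasDerivAt_id s).const_sub p.1.z)).prodMk (hasDerivAt_const s p.2)
  refine h1.congr_deriv ?_
  have h2 := h.sq_add_sq p.2.2
  rw [hp] at h2
  have h3 : ψ p.2.2 ^ 2 = 1 := by linarith
  refine Prod.ext (Heisenberg.ext ?_ ?_ ?_) (Prod.ext ?_ rfl) <;>
    simp [field, verticalFlow, hp, h3]

theorem isCircleFlow : IsCircleFlow thurstonProj (field φ ψ) (flow φ ψ) (period φ) where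
  apply_zero p := by
    unfold flow
    split_ifs
    · exact Prod.ext (Heisenberg.ext rfl rfl (sub_zero _)) rfl
    · simp only [circularFlow, mul_zero, add_zero, sub_self, sub_zero]
      rfl
  contDiff p := by
    unfold flow
    split_ifs
    exacts [contDiff_verticalFlow p, contDiff_circularFlow φ ψ p]
  hasDerivAt p t := by
    unfold flow
    split_ifs with hp
    exacts [h.hasDerivAt_verticalFlow hp t, hasDerivAt_circularFlow hp t]
  period_pos p := by
    unfold period
    split_ifs with hp
    exacts [one_pos, by positivity]
  periodic p := by
    unfold flow period
    split_ifs with hp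
    exacts [periodic_verticalFlow p, periodic_circularFlow hp]
  injOn p := by
    unfold flow period
    split_ifs with hp
    exacts [injOn_verticalFlow p, injOn_circularFlow hp]

theorem n_ne_zero : n ≠ 0 := fun h0 => by
  have := h.one_le
  simp [h0] at this

/-- The coordinate form of the geodesic equation `D_V V = 0` for `V = field φ ψ`. -/
theorem geodesic_equation (p w : ThurstonCover) :
    metricForm φ ψ σ p (fderiv ℝ (field φ ψ) p (field φ ψ p)) w
      + fderiv ℝ (metricForm φ ψ σ) p (field φ ψ p) (field φ ψ p) w
      - fderiv ℝ (metricForm φ ψ σ) p w (field φ ψ p) (field φ ψ p) / 2 = 0 := by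
  have hV := (h.contDiff_field.differentiable h.n_ne_zero p).hasFDerivAt
  have hG := (h.contDiff_metricForm.differentiable h.n_ne_zero p).hasFDerivAt
  have hu : HasFDerivAt (fun q : ThurstonCover => q.2.2) du p := du.hasFDerivAt
  have hσ := (h.contDiff_trd.differentiable h.n_ne_zero p.2.2).hasDerivAt
  have hf := (((h.contDiff_fst.pow 2).differentiable h.n_ne_zero) p.2.2).hasDerivAt
  have hσu := hσ.comp_hasFDerivAt p hu
  have hfu := hf.comp_hasFDerivAt p hu
  -- The metric is never differentiated explicitly. Differentiating `g(V, w) = du(w) + σ dt(w)`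
  -- along `V`, where `du(V) = 0`, makes the first two terms of the claim cancel.
  have h1 := (hG.clm_apply hV).clm_apply (hasFDerivAt_const w p)
  have h2 : HasFDerivAt (fun q => metricForm φ ψ σ q (field φ ψ q) w) _ p :=
    ((hσu.mul_const w.2.1).const_add w.2.2).congr_of_eventuallyEq
      (Eventually.of_forall fun q => h.metricForm_field q w)
  have h3 := congrArg (fun L : ThurstonCover →L[ℝ] ℝ => L (field φ ψ p)) (h1.unique h2)
  -- Differentiating `g(V, V) = 2σφ²` along `w` and removing the two terms `g(V, DV w) = 2σ(φ²)'
  -- du(w)` leaves `(σ'φ² - σ(φ²)') du(w)` for half the derivative of `g`.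
  have h4 := (hG.clm_apply hV).clm_apply hV
  have h5 : HasFDerivAt (fun q => metricForm φ ψ σ q (field φ ψ q) (field φ ψ q)) _ p :=
    ((hσu.mul (hfu.const_mul 2)).const_add 0).congr_of_eventuallyEq
      (Eventually.of_forall fun q => h.metricForm_field q (field φ ψ q))
  have h6 := congrArg (fun L : ThurstonCover →L[ℝ] ℝ => L w) (h4.unique h5)
  have h7 : (fderiv ℝ (field φ ψ) p w).2.1 = 2 * (deriv (fun s => φ s ^ 2) p.2.2 * w.2.2) := by
    have h8 := (dt.hasFDerivAt (x := field φ ψ p)).comp p hV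
    have h9 : HasFDerivAt (dt ∘ field φ ψ) _ p := hfu.const_mul 2
    have := congrArg (fun L : ThurstonCover →L[ℝ] ℝ => L w) (h8.unique h9)
    simpa using this
  have h10 : (fderiv ℝ (field φ ψ) p w).2.2 = 0 := by
    have h8 := (du.hasFDerivAt (x := field φ ψ p)).comp p hV
    have h9 : HasFDerivAt (du ∘ field φ ψ) (0 : ThurstonCover →L[ℝ] ℝ) p := hasFDerivAt_const 0 p
    exact congrArg (fun L : ThurstonCover →L[ℝ] ℝ => L w) (h8.unique h9)
  have h12 := h.metricForm_field p (fderiv ℝ (field φ ψ) p w)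
  rw [h7, h10] at h12
  have h11 := (metricForm_symm φ ψ σ p (fderiv ℝ (field φ ψ) p w) (field φ ψ p)).trans h12
  have h13 := h.deriv_mul p.2.2
  have h14 : (field φ ψ p).2.2 = 0 := rfl
  simp [h14] at h3
  simp [h11, h12] at h6
  linear_combination h3 - h6 / 2 - w.2.2 * h13

end IsProfile

/-! ### The foliation and the metrics on the compact manifold -/

open ThurstonCover

/-- The Riemannian metric on `N × S¹ × S¹` induced by `riemannForm`. -/
def thurstonRiemannianMetric : Bundle.ContMDiffRiemannianMetric thurstonModel ∞
    (Heisenberg × ℝ × ℝ) (fun x : ThurstonManifold => TangentSpace thurstonModel x) where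
  inner := descendForm thurstonModel riemannForm
  symm _ := riemannForm_symm _
  pos _ _ hv := riemannForm_pos _ hv
  isVonNBounded x := by
    let p : ThurstonCover := extChartAt thurstonModel x x
    refine (NormedSpace.isVonNBounded_iff' ℝ (E := ThurstonCover)).2
      ⟨2 + 2 * |p.1.x|, fun v hv => norm_le_of_riemannForm_lt_one (p := p) hv⟩
  contMDiff := isChartCover_thurstonProj.contMDiff_form isInvariantForm_riemannForm
    contDiff_riemannForm

namespace IsProfile

variable {n : ℕ∞ω} {φ ψ σ : ℝ → ℝ} (h : IsProfile n φ ψ σ)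
include h

/-- The pseudo-Riemannian metric on `N × S¹ × S¹` induced by `metricForm`. -/
def metric : PseudoRiemannianMetric thurstonModel ThurstonManifold n where
  inner := descendForm thurstonModel (metricForm φ ψ σ)
  symm _ := metricForm_symm φ ψ σ _
  nondegenerate _ := h.metricForm_nondegenerate _
  contMDiff := isChartCover_thurstonProj.contMDiff_form h.isInvariantForm h.contDiff_metricForm

/-- The foliation of `N × S¹ × S¹` induced by `field`. -/
def foliation : LineFoliation thurstonModel ThurstonManifold n :=
  isChartCover_thurstonProj.foliation h.isInvariantField h.contDiff_field h.field_ne_zero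

theorem isByCircles : h.foliation.IsByCircles :=
  isChartCover_thurstonProj.isByCircles h.isInvariantField h.contDiff_field h.field_ne_zero
    h.isCircleFlow h.one_le

theorem hasUnboundedLength (hφ : ∀ C, ∃ u, φ u ≠ 0 ∧ C < π / φ u ^ 2) :
    h.foliation.HasUnboundedLength := by
  have hT : ∀ C, ∃ p, C < period φ p := fun C => by
    obtain ⟨u, hu, hC⟩ := hφ C
    refine ⟨(0, 0, u), ?_⟩
    unfold period
    rwa [if_neg hu]
  have key := isChartCover_thurstonProj.unboundedLengthFor h.isInvariantField h.contDiff_field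
    h.field_ne_zero h.isCircleFlow h.one_le hT
  exact ⟨⟨thurstonRiemannianMetric, key _⟩, key⟩

theorem isGeodesic : h.foliation.IsGeodesic h.metric := by
  intro x
  have hP := isChartCover_thurstonProj
  have hx := hP.extChartAt_self x
  generalize extChartAt thurstonModel x x = p at hx
  subst hx
  exact ⟨_, _, hP.isCircleParam_flow h.isInvariantField h.contDiff_field h.field_ne_zero
    h.isCircleFlow h.one_le p, hP.isGeodesic_of_isIntegralCurve h.isInvariantField
    (h.contDiff_field.differentiable h.n_ne_zero) h.isInvariantForm
    (h.contDiff_metricForm.differentiable h.n_ne_zero) h.geodesic_equation h.metric rfl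
    (hP.contMDiff_flow h.isCircleFlow p) (hP.velocity_flow h.isInvariantField h.isCircleFlow p)⟩

/-- `u` is constant along orbits, so `g(V, V) = 2σφ²` takes one value on the leaf; a tangent vector
is a multiple of `V` and contributes the square of its factor. -/
theorem exists_inner_eq_mul (p : ThurstonCover) {y : ThurstonManifold}
    (hy : y ∈ h.foliation.leaf (thurstonProj p)) {v : TangentSpace thurstonModel y}
    (hv : v ∈ h.foliation.line y) (hv0 : v ≠ 0) :
    ∃ a > 0, h.metric.inner y v v = a * (2 * σ p.2.2 * φ p.2.2 ^ 2) := by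
  have hP := isChartCover_thurstonProj
  have hleaf := hP.leaf_eq_range h.isInvariantField h.contDiff_field h.field_ne_zero
    h.isCircleFlow h.one_le p
  obtain ⟨s, rfl⟩ := hleaf.subset hy
  obtain ⟨a, rfl⟩ := Submodule.mem_span_singleton.1 hv
  have ha : a ≠ 0 := fun ha => hv0 (by rw [ha, zero_smul])
  refine ⟨a ^ 2, by positivity, ?_⟩
  have h1 := hP.descendForm_mfderiv h.isInvariantForm (flow φ ψ p s)
    (field φ ψ (flow φ ψ p s)) (field φ ψ (flow φ ψ p s))
  rw [hP.mfderiv_field h.isInvariantField, h.metricForm_field, flow_snd_snd] at h1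
  have h2 : (field φ ψ (flow φ ψ p s)).2.2 = 0 := rfl
  have h3 : (field φ ψ (flow φ ψ p s)).2.1 = 2 * φ p.2.2 ^ 2 := by
    rw [← flow_snd_snd φ ψ p s]; rfl
  rw [h2, h3] at h1
  have h4 : h.metric.inner ((thurstonProj ∘ flow φ ψ p) s)
      (a • descendField thurstonModel (field φ ψ) ((thurstonProj ∘ flow φ ψ p) s))
      (a • descendField thurstonModel (field φ ψ) ((thurstonProj ∘ flow φ ψ p) s))
      = a * (a * (0 + σ p.2.2 * (2 * φ p.2.2 ^ 2))) := by
    rw [← h1]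
    rw [map_smul, map_smul, smul_apply, smul_eq_mul, smul_eq_mul]
    rfl
  rw [h4]
  ring

end IsProfile

/-! ### The analytic and the smooth profile -/

theorem exists_lt_pi_div_sq {f : ℝ → ℝ} (hf : ContinuousAt f 0) (h0 : f 0 = 0)
    (hpos : ∀ᶠ u in 𝓝[>] 0, f u ≠ 0) (C : ℝ) : ∃ u, f u ≠ 0 ∧ C < π / f u ^ 2 := by
  have h1 : Tendsto (fun u => f u ^ 2) (𝓝[>] 0) (𝓝[>] 0) := by
    refine tendsto_nhdsWithin_iff.2 ⟨?_, ?_⟩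
    · have : Tendsto (fun u => f u ^ 2) (𝓝 0) (𝓝 (f 0 ^ 2)) := (hf.pow 2).tendsto
      rw [h0, zero_pow two_ne_zero] at this
      exact this.mono_left nhdsWithin_le_nhds
    · filter_upwards [hpos] with u hu
      exact mem_Ioi.2 (by positivity)
  have h2 : Tendsto (fun u => π / f u ^ 2) (𝓝[>] 0) atTop :=
    (tendsto_inv_nhdsGT_zero.comp h1).const_mul_atTop Real.pi_pos
  obtain ⟨u, hu, hC⟩ := (hpos.and (h2.eventually_gt_atTop C)).exists
  exact ⟨u, hu, hC⟩

theorem eventually_sin_pos : ∀ᶠ u in 𝓝[>] (0 : ℝ), 0 < Real.sin u := by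
  filter_upwards [Ioo_mem_nhdsGT Real.pi_pos] with u hu
  exact Real.sin_pos_of_mem_Ioo hu

/-- For `σ = 0` the geodesic condition is trivial, so `φ` need not be flat at its zeros and can be
analytic. -/
theorem isProfile_sin_cos : IsProfile ω Real.sin Real.cos (fun _ => 0) where
  one_le := le_top
  contDiff_fst := Real.contDiff_sin
  contDiff_snd := Real.contDiff_cos
  contDiff_trd := contDiff_const
  periodic_fst := Real.sin_periodic
  periodic_snd := Real.cos_periodic
  periodic_trd _ := rfl
  sq_add_sq := Real.sin_sq_add_cos_sq
  lt_one _ := by simp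
  deriv_mul _ := by simp

/-- A smooth function of the angle that vanishes to infinite order at the multiples of `π`. -/
def flatSin (u : ℝ) : ℝ := expNegInvGlue (Real.sin u) + expNegInvGlue (-Real.sin u)

/-- The square of `flatSin` with the sign of `sin`. -/
def signedFlatSin (u : ℝ) : ℝ := expNegInvGlue (Real.sin u) ^ 2 - expNegInvGlue (-Real.sin u) ^ 2

theorem expNegInvGlue_mul_neg (s : ℝ) : expNegInvGlue s * expNegInvGlue (-s) = 0 := by
  rcases le_total s 0 with hs | hs
  · rw [expNegInvGlue.zero_of_nonpos hs, zero_mul]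
  · rw [expNegInvGlue.zero_of_nonpos (neg_nonpos.2 hs), mul_zero]

/-- For `0 < s ≤ 1`, `exp(1/s) ≥ 1 + 1/s ≥ 2`. The bound keeps `φ²` at most `1/2`, hence `√(1 - φ²)`
smooth and `2σφ² < 1`. -/
theorem expNegInvGlue_le {s : ℝ} (hs : s ≤ 1) : expNegInvGlue s ≤ 1 / 2 := by
  rcases le_or_gt s 0 with h | h
  · rw [expNegInvGlue.zero_of_nonpos h]; norm_num
  · rw [expNegInvGlue, if_neg h.not_ge]
    have h1 : 1 ≤ s⁻¹ := (one_le_inv₀ h).2 hs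
    have h2 : 2 ≤ Real.exp s⁻¹ := by linarith [Real.add_one_le_exp s⁻¹]
    rw [Real.exp_neg, ← one_div]
    exact one_div_le_one_div_of_le two_pos h2

theorem flatSin_sq (u : ℝ) :
    flatSin u ^ 2 = expNegInvGlue (Real.sin u) ^ 2 + expNegInvGlue (-Real.sin u) ^ 2 := by
  rw [flatSin]
  linear_combination 2 * expNegInvGlue_mul_neg (Real.sin u)

theorem flatSin_sq_le (u : ℝ) : flatSin u ^ 2 ≤ 1 / 2 := by
  rw [flatSin_sq]
  have h1 := expNegInvGlue_le (Real.sin_le_one u)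
  have h2 : expNegInvGlue (-Real.sin u) ≤ 1 / 2 :=
    expNegInvGlue_le (by linarith [Real.neg_one_le_sin u])
  have h3 := expNegInvGlue.nonneg (Real.sin u)
  have h4 := expNegInvGlue.nonneg (-Real.sin u)
  nlinarith

theorem contDiff_expNegInvGlue_sin :
    ContDiff ℝ ∞ fun u => expNegInvGlue (Real.sin u) :=
  expNegInvGlue.contDiff.comp Real.contDiff_sin

theorem contDiff_expNegInvGlue_neg_sin :
    ContDiff ℝ ∞ fun u => expNegInvGlue (-Real.sin u) :=
  expNegInvGlue.contDiff.comp Real.contDiff_sin.neg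

theorem contDiff_flatSin : ContDiff ℝ ∞ flatSin :=
  contDiff_expNegInvGlue_sin.add contDiff_expNegInvGlue_neg_sin

/-- `σ / φ²` is `1` where `sin u > 0` and `-1` where `sin u < 0`; flatness of `φ` at the zeros of
`sin` lets the two constants be glued smoothly. -/
theorem isProfile_flatSin :
    IsProfile ∞ flatSin (fun u => √(1 - flatSin u ^ 2)) signedFlatSin where
  one_le := by simp
  contDiff_fst := contDiff_flatSin
  contDiff_snd := (contDiff_const.sub (contDiff_flatSin.pow 2)).sqrt
    fun u => by linarith [flatSin_sq_le u]
  contDiff_trd := (contDiff_expNegInvGlue_sin.pow 2).sub (contDiff_expNegInvGlue_neg_sin.pow 2)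
  periodic_fst u := by simp [flatSin]
  periodic_snd u := by simp [flatSin]
  periodic_trd u := by simp [signedFlatSin]
  sq_add_sq u := by
    rw [Real.sq_sqrt (by linarith [flatSin_sq_le u])]
    ring
  lt_one u := by
    have h1 := flatSin_sq_le u
    have h2 := flatSin_sq u
    have h3 := sq_nonneg (expNegInvGlue (-Real.sin u))
    have h4 : signedFlatSin u ≤ flatSin u ^ 2 := by rw [signedFlatSin, h2]; linarith
    nlinarith [sq_nonneg (flatSin u)]
  deriv_mul u := by
    have h1 := ((contDiff_expNegInvGlue_sin.differentiable (by simp)) u).hasDerivAt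
    have h2 := ((contDiff_expNegInvGlue_neg_sin.differentiable (by simp)) u).hasDerivAt
    have h3 : deriv signedFlatSin u = _ := ((h1.pow 2).sub (h2.pow 2)).deriv
    have h4 : deriv (fun s => expNegInvGlue (Real.sin s) ^ 2 + expNegInvGlue (-Real.sin s) ^ 2) u
      = _ := ((h1.pow 2).add (h2.pow 2)).deriv
    simp only [flatSin_sq]
    rw [h3, h4, signedFlatSin]
    set a' := deriv (fun s => expNegInvGlue (Real.sin s)) u
    set b' := deriv (fun s => expNegInvGlue (-Real.sin s)) u
    push_cast
    -- With `a`, `b` the two bump functions, `σ'φ² - σ(φ²)' = 4ab(a'b - b'a)`, and `ab = 0`.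
    linear_combination 4 * (a' * expNegInvGlue (-Real.sin u) - b' * expNegInvGlue (Real.sin u))
      * expNegInvGlue_mul_neg (Real.sin u)

end

/-! ### The theorem -/

theorem mainTheorem2 :
    (CompactSpace ThurstonManifold ∧ T2Space ThurstonManifold ∧ ConnectedSpace ThurstonManifold ∧
      IsManifold thurstonModel ω ThurstonManifold) ∧
    (∃ (F : LineFoliation thurstonModel ThurstonManifold ω)
      (g : PseudoRiemannianMetric thurstonModel ThurstonManifold ω),
      F.IsByCircles ∧ F.HasUnboundedLength ∧ F.IsGeodesic g ∧
      ∀ x, F.IsLightlikeLeaf g x) ∧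
    (∃ (F : LineFoliation thurstonModel ThurstonManifold ∞)
      (g : PseudoRiemannianMetric thurstonModel ThurstonManifold ∞),
      F.IsByCircles ∧ F.HasUnboundedLength ∧ F.IsGeodesic g ∧
      (∃ x, F.IsSpacelikeLeaf g x) ∧ (∃ x, F.IsTimelikeLeaf g x) ∧
      ∃ x, F.IsLightlikeLeaf g x) := by
  refine ⟨⟨inferInstance, inferInstance, inferInstance, inferInstance⟩, ?_, ?_⟩
  · have h := isProfile_sin_cos
    refine ⟨h.foliation, h.metric, h.isByCircles, h.hasUnboundedLength ?_, h.isGeodesic, ?_⟩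
    · exact exists_lt_pi_div_sq Real.continuous_sin.continuousAt Real.sin_zero
        (eventually_sin_pos.mono fun u hu => hu.ne')
    · intro x y hy v hv hv0
      rw [← isChartCover_thurstonProj.extChartAt_self x] at hy
      obtain ⟨a, -, ha⟩ := h.exists_inner_eq_mul _ hy hv hv0
      rw [ha]
      simp
  · have h := isProfile_flatSin
    have h1 : expNegInvGlue 1 > 0 := expNegInvGlue.pos_of_pos one_pos
    have h2 : expNegInvGlue (-1) = 0 := expNegInvGlue.zero_of_nonpos (by norm_num)
    -- At these three points `sin u` is `1`, `-1` and `0`, so `σφ²` is positive, negative and zero.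
    refine ⟨h.foliation, h.metric, h.isByCircles, h.hasUnboundedLength ?_, h.isGeodesic,
      ⟨thurstonProj (0, 0, π / 2), ?_⟩, ⟨thurstonProj (0, 0, -(π / 2)), ?_⟩,
      thurstonProj (0, 0, 0), ?_⟩
    · refine exists_lt_pi_div_sq contDiff_flatSin.continuous.continuousAt (by simp [flatSin])
        (eventually_sin_pos.mono fun u hu => ?_)
      exact (add_pos_of_pos_of_nonneg (expNegInvGlue.pos_of_pos hu) (expNegInvGlue.nonneg _)).ne'
    · intro y hy v hv hv0
      obtain ⟨a, ha0, ha⟩ := h.exists_inner_eq_mul _ hy hv hv0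
      rw [ha]
      simp only [flatSin, signedFlatSin, Real.sin_pi_div_two, h2]
      have : 0 < a * (2 * expNegInvGlue 1 ^ 2 * expNegInvGlue 1 ^ 2) := by positivity
      linarith
    · intro y hy v hv hv0
      obtain ⟨a, ha0, ha⟩ := h.exists_inner_eq_mul _ hy hv hv0
      rw [ha]
      simp only [flatSin, signedFlatSin, Real.sin_neg, Real.sin_pi_div_two, h2, neg_neg]
      have : 0 < a * (2 * expNegInvGlue 1 ^ 2 * expNegInvGlue 1 ^ 2) := by positivity
      linarith
    · intro y hy v hv hv0
      obtain ⟨a, ha0, ha⟩ := h.exists_inner_eq_mul _ hy hv hv0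
      rw [ha]
      simp [flatSin]
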